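/- Consider the linear model $\mathbf Y = X\beta_\star+\varepsilon$ with fixed $X\in\mathbb R^{n\times d}$, square integrable noise with $\mathbb E[\varepsilon]=0$, $\mathrm{Cov}(\varepsilon)=I_n$. Write $\mathbb X:=X^\top X$, and for a $d\times d$ matrix $A$ let $\mathrm{Diag}(A)$ be the diagonal matrix with the same diagonal as $A$, $\overline A:=A-\mathrm{Diag}(A)$, $A_p:=pA+(1-p)\mathrm{Diag}(A)$; $\odot$ is the entrywise product, $\|\cdot\|$ the spectral norm and $\lambda_{\min}$ the smallest eigenvalue. Let $p\in(0,1)$, $\alpha>0$, and let $D_1,D_2,\dots$ be i.i.d. random diagonal $d\times d$ matrices with i.i.d. $\mathrm{Ber}(p)$ diagonal entries. Gradient descent with dropout is $$\tilde\beta_{k+1}=\tilde\beta_k+\alpha D_{k+1}X^\top\big(\mathbf Y-XD_{k+1}\tilde\beta_k\big),\qquad k=0,1,2,\dots,$$ where the initialization $\tilde\beta_0$ is square integrable and independent of $\mathbf Y$, and $(D_k)_{k\ge1}$ is independent of $(\mathbf Y,\tilde\beta_0)$. Assume that $X$ has no zero column, $\alpha p\|\mathbb X\|<1$ and $\alpha<\lambda_{\min}(\mathbb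 X_p)/(3\|\mathbb X\|^2)$. Let $\tilde\beta:=\mathbb X_p^{-1}X^\top\mathbf Y$, and $\tilde\beta^{\mathrm{rp}}_k:=\frac1k\sum_{\ell=1}^k\tilde\beta_\ell$. Then $\tilde\beta$ is the unique minimizer of the marginalized loss $\beta\mapsto\mathbb E[\|\mathbf Y-XD\beta\|_2^2\mid\mathbf Y]$ (with $D$ distributed as $D_1$ and independent of $\mathbf Y$), and for every $k=1,2,\dots$ the vector $\tilde\beta^{\mathrm{rp}}_k-\tilde\beta$ is square integrable with $$\Big\|\mathbb E\big[(\tilde\beta^{\mathrm{rp}}_k-\tilde\beta)(\tilde\beta^{\mathrm{rp}}_k-\tilde\beta)^\top\big]\Big\|\le\frac{2\|\mathbb X\|^2\,\big\|\mathbb E[X^\top\mathbf Y\mathbf Y^\top X]\big\|}{k(1-p)^3(\min_i\mathbb X_{ii})^4}+\frac{2C}{k^2\big(\alpha p(1-p)\min_i\mathbb X_{ii}\big)^3},$$ where $$C:=\Big\|\mathbb E\big[(\tilde\beta_0-\tilde\beta)(\tilde\beta_0-\tilde\beta)^\top\big]-(\mathrm{id}-S_{\mathrm{lin}})^{-1}S_0\Big\|+6\Big\|\mathbb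 E\big[(\tilde\beta_0-\tilde\beta)\tilde\beta^\top\big]\Big\|+\Big\|\mathbb E\big[\tilde\beta_0-\tilde\beta\big]\Big\|_2^2,$$ $S_0:=S(0)$, $S_{\mathrm{lin}}(A):=S(A)-S_0$, and $S$ is the affine operator on $\mathbb R^{d\times d}$ given, with $B:=\mathbb E[\tilde\beta\tilde\beta^\top]$, by $$\begin{aligned}S(A)={}&(I-\alpha p\mathbb X_p)A(I-\alpha p\mathbb X_p)+\alpha^2p(1-p)\mathrm{Diag}(\mathbb X_pA\mathbb X_p)+\alpha^2p^2(1-p)^2\,\mathbb X\odot\overline{A+B}\odot\mathbb X\\&+\alpha^2p^2(1-p)\Big(\big(\overline{\mathbb X}\,\mathrm{Diag}(A+B)\,\overline{\mathbb X}\big)_p+\overline{\mathbb X}\,\mathrm{Diag}(\mathbb X_pA)+\mathrm{Diag}(\mathbb X_pA)\,\overline{\mathbb X}\Big).\end{aligned}$$ In particular $\mathbb E\big[\|\tilde\beta^{\mathrm{rp}}_k-\tilde\beta\|_2^2\big]\to0$ as $k\to\infty$. -/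

import Mathlib

open MeasureTheory ProbabilityTheory Filter Topology
open scoped Matrix
-- The norm on matrices is the spectral norm, induced by the Euclidean norm.
open scoped Matrix.Norms.L2Operator

noncomputable section

namespace Dropout

variable {Ω : Type*} [MeasurableSpace Ω] {n d : ℕ}

/-- Squared Euclidean norm. -/
def sqNorm {m : ℕ} (v : Fin m → ℝ) : ℝ := ∑ i, v i ^ 2

/-- `Diag(A)`: the diagonal matrix with the same main diagonal as `A`. -/
def diagPart (A : Matrix (Fin d) (Fin d) ℝ) : Matrix (Fin d) (Fin d) ℝ :=
  Matrix.diagonal A.diag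

/-- `A - Diag(A)`. -/
def offDiag (A : Matrix (Fin d) (Fin d) ℝ) : Matrix (Fin d) (Fin d) ℝ :=
  A - diagPart A

/-- `A_p = p A + (1 - p) Diag(A)`. -/
def pPart (p : ℝ) (A : Matrix (Fin d) (Fin d) ℝ) : Matrix (Fin d) (Fin d) ℝ :=
  p • A + (1 - p) • diagPart A

/-- The Gram matrix `𝕏 = Xᵀ X`. -/
def gram (X : Matrix (Fin n) (Fin d) ℝ) : Matrix (Fin d) (Fin d) ℝ := Xᵀ * X

/-- Smallest eigenvalue of a symmetric matrix. -/
def lambdaMin (A : Matrix (Fin d) (Fin d) ℝ) : ℝ := sInf (spectrum ℝ A)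

/-- `min_i 𝕏_{ii}`. -/
def minDiag (A : Matrix (Fin d) (Fin d) ℝ) : ℝ := ⨅ i, A i i

/-- Entrywise expectation `E[U]` of a random vector. -/
def expVec {m : ℕ} (μ : Measure Ω) (U : Ω → Fin m → ℝ) : Fin m → ℝ :=
  fun i => ∫ ω, U ω i ∂μ

/-- Entrywise expectation `E[U Vᵀ]` for two random vectors. -/
def expOuter {m l : ℕ} (μ : Measure Ω) (U : Ω → Fin m → ℝ) (V : Ω → Fin l → ℝ) :
    Matrix (Fin m) (Fin l) ℝ :=
  Matrix.of fun i j => ∫ ω, U ω i * V ω j ∂μ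

/-- `U` is a square integrable random vector. -/
def SquareIntegrable {m : ℕ} (μ : Measure Ω) (U : Ω → Fin m → ℝ) : Prop :=
  ∀ i, MemLp (fun ω => U ω i) 2 μ

/-- A `p`-dropout matrix: a random diagonal matrix with i.i.d. `Ber(p)` diagonal entries. -/
structure IsDropoutMatrix (μ : Measure Ω) (p : unitInterval)
    (D : Ω → Matrix (Fin d) (Fin d) ℝ) : Prop where
  isDiag : ∀ ω, (D ω).IsDiag
  measurable : ∀ i, Measurable fun ω => D ω i i
  law : ∀ i, μ.map (fun ω => D ω i i) = bernoulliMeasure (1 : ℝ) 0 p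
  indep : iIndepFun (fun i ω => D ω i i) μ

/-- The marginalized loss `β ↦ E[‖y - X D β‖₂²]`, where the expectation is over the dropout
matrix `D` only and the data vector `y` is held fixed. -/
def marginalLoss (μ : Measure Ω) (X : Matrix (Fin n) (Fin d) ℝ)
    (D : Ω → Matrix (Fin d) (Fin d) ℝ) (y : Fin n → ℝ) (β : Fin d → ℝ) : ℝ :=
  ∫ ω, sqNorm (y - X *ᵥ (D ω *ᵥ β)) ∂μ

/-- `β̃ = 𝕏_p⁻¹ Xᵀ y`. -/
def betaTilde (p : ℝ) (X : Matrix (Fin n) (Fin d) ℝ) (y : Fin n → ℝ) : Fin d → ℝ :=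
  (pPart p (gram X))⁻¹ *ᵥ (Xᵀ *ᵥ y)

/-- Gradient descent with dropout. The matrix `D k` is the one used in the step from the `k`-th
to the `(k + 1)`-th iterate, so it is what is usually written `D_{k+1}`. -/
def iterate (α : ℝ) (X : Matrix (Fin n) (Fin d) ℝ) (D : ℕ → Ω → Matrix (Fin d) (Fin d) ℝ)
    (Y : Ω → Fin n → ℝ) (β₀ : Ω → Fin d → ℝ) : ℕ → Ω → Fin d → ℝ
  | 0 => β₀
  | k + 1 => fun ω =>
      iterate α X D Y β₀ k ω +
        α • (D k ω *ᵥ (Xᵀ *ᵥ (Y ω - X *ᵥ (D k ω *ᵥ iterate α X D Y β₀ k ω))))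

/-- Ruppert–Polyak average `k⁻¹ ∑_{ℓ=1}^k β̃_ℓ`. -/
def rpAverage (α : ℝ) (X : Matrix (Fin n) (Fin d) ℝ) (D : ℕ → Ω → Matrix (Fin d) (Fin d) ℝ)
    (Y : Ω → Fin n → ℝ) (β₀ : Ω → Fin d → ℝ) (k : ℕ) (ω : Ω) : Fin d → ℝ :=
  (k : ℝ)⁻¹ • ∑ l ∈ Finset.Icc 1 k, iterate α X D Y β₀ l ω

/-- The affine operator `S`, with `G = 𝕏` and `B = E[β̃ β̃ᵀ]`. -/
def opS (α p : ℝ) (G B A : Matrix (Fin d) (Fin d) ℝ) : Matrix (Fin d) (Fin d) ℝ :=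
  (1 - (α * p) • pPart p G) * A * (1 - (α * p) • pPart p G)
    + (α ^ 2 * p * (1 - p)) • diagPart (pPart p G * A * pPart p G)
    + (α ^ 2 * p ^ 2 * (1 - p) ^ 2) • (G ⊙ offDiag (A + B) ⊙ G)
    + (α ^ 2 * p ^ 2 * (1 - p)) •
        (pPart p (offDiag G * diagPart (A + B) * offDiag G)
          + offDiag G * diagPart (pPart p G * A)
          + diagPart (pPart p G * A) * offDiag G)

theorem diagPart_add (A B : Matrix (Fin d) (Fin d) ℝ) :
    diagPart (A + B) = diagPart A + diagPart B := by
  simp [diagPart, Matrix.diag_add, Matrix.diagonal_add]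

theorem diagPart_smul (c : ℝ) (A : Matrix (Fin d) (Fin d) ℝ) :
    diagPart (c • A) = c • diagPart A := by
  simp [diagPart, Matrix.diag_smul, Matrix.diagonal_smul]

theorem offDiag_add (A B : Matrix (Fin d) (Fin d) ℝ) :
    offDiag (A + B) = offDiag A + offDiag B := by
  simp only [offDiag, diagPart_add]; abel

theorem offDiag_smul (c : ℝ) (A : Matrix (Fin d) (Fin d) ℝ) :
    offDiag (c • A) = c • offDiag A := by
  simp only [offDiag, diagPart_smul, smul_sub]

theorem pPart_add (p : ℝ) (A B : Matrix (Fin d) (Fin d) ℝ) :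
    pPart p (A + B) = pPart p A + pPart p B := by
  simp only [pPart, diagPart_add, smul_add]; abel

theorem pPart_smul (p c : ℝ) (A : Matrix (Fin d) (Fin d) ℝ) :
    pPart p (c • A) = c • pPart p A := by
  simp only [pPart, diagPart_smul]; module

theorem opS_zero (α p : ℝ) (G B : Matrix (Fin d) (Fin d) ℝ) :
    opS α p G B 0 = (α ^ 2 * p ^ 2 * (1 - p) ^ 2) • (G ⊙ offDiag B ⊙ G)
      + (α ^ 2 * p ^ 2 * (1 - p)) • pPart p (offDiag G * diagPart B * offDiag G) := by
  simp [opS, diagPart]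

/-- The linear part is unaffected by `B`. -/
theorem opS_sub_zero (α p : ℝ) (G B A : Matrix (Fin d) (Fin d) ℝ) :
    opS α p G B A - opS α p G B 0 = opS α p G 0 A := by
  rw [opS_zero]
  simp only [opS, diagPart_add, offDiag_add, pPart_add, add_zero, mul_add, add_mul,
    Matrix.hadamard_add, Matrix.add_hadamard, smul_add]
  abel

/-- The linear part `S_lin(A) = S(A) - S(0)` of `S`. -/
def opSLin (α p : ℝ) (G B : Matrix (Fin d) (Fin d) ℝ) :
    Module.End ℝ (Matrix (Fin d) (Fin d) ℝ) where
  toFun A := opS α p G B A - opS α p G B 0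
  map_add' A A' := by
    simp only [opS_sub_zero]
    simp only [opS, diagPart_add, offDiag_add, pPart_add, add_zero, mul_add, add_mul,
      Matrix.hadamard_add, Matrix.add_hadamard, smul_add]
    abel
  map_smul' c A := by
    simp only [opS_sub_zero, RingHom.id_apply]
    simp only [opS, add_zero, Matrix.mul_smul, Matrix.smul_mul, diagPart_smul, offDiag_smul,
      pPart_smul, Matrix.hadamard_smul, Matrix.smul_hadamard, smul_add,
      smul_comm _ c]

/-- `(id - S_lin)⁻¹ S₀` with `S₀ = S(0)`. -/
def limitMatrix (α p : ℝ) (G B : Matrix (Fin d) (Fin d) ℝ) : Matrix (Fin d) (Fin d) ℝ :=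
  Ring.inverse (1 - opSLin α p G B) (opS α p G B 0)

/-- The constant
`C = ‖E[(β₀ - β̃)(β₀ - β̃)ᵀ] - (id - S_lin)⁻¹ S₀‖ + 6 ‖E[(β₀ - β̃) β̃ᵀ]‖ + ‖E[β₀ - β̃]‖₂²`. -/
def constC (μ : Measure Ω) (α p : ℝ) (X : Matrix (Fin n) (Fin d) ℝ)
    (Y : Ω → Fin n → ℝ) (β₀ : Ω → Fin d → ℝ) : ℝ :=
  let βt : Ω → Fin d → ℝ := fun ω => betaTilde p X (Y ω)
  let Z : Ω → Fin d → ℝ := fun ω => β₀ ω - βt ω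
  ‖expOuter μ Z Z - limitMatrix α p (gram X) (expOuter μ βt βt)‖
    + 6 * ‖expOuter μ Z βt‖ + sqNorm (expVec μ Z)

end Dropout

end

noncomputable section

namespace Dropout

variable {Ω : Type*} [MeasurableSpace Ω] {n d : ℕ}

section

/-! ### The spectral norm through bilinear forms -/

/-! Write `G = 𝕏`, `b = β̃` and `Z k` for the error of the `k`-th iterate. Since `𝕏_p b = Xᵀ Y` and
the dropout entries are 0 or 1, the error obeys `Z (k+1) = M Z k + N b` with `M = 1 - α D G D` and
`N = α D (G - Diag G) (p - D)` (`step_sub_eq`). The matrix `D` is independent of the past, `E M = 1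
- α p 𝕏_p` has norm at most `q = 1 - α p λ`, where `λ = λ_min(𝕏_p)`, and `E N = 0`. Hence `E[Z l (Z
m)ᵀ]` decays like `q ^ (l - m)` for `m ≤ l`, and `E[Z k bᵀ]` like `q ^ k`.

For the second moments, the `M M` and `N N` terms of the recursion together are exactly `S`
(`sum_integral_eq_opS`), obtained from the fourth mixed moments of the dropout entries. The two
cross terms are controlled by `E[Z k bᵀ]`, so `E[Z (k+1) Z (k+1)ᵀ] = S(E[Z k Z kᵀ])` up to an error
of order `q ^ k`. The step-size condition makes the linear part of `S` a contraction with the same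
factor `q` (`norm_opSLin_le`). The distances of the second moments to the fixed point `(id -
S_lin)⁻¹ S₀` are therefore summable, with a bound uniform in `k`, and the fixed point has norm at
most `‖S₀‖ / (1 - q)`.

Expanding the second moment of the average into a double sum and using the geometric decay away from
the diagonal costs a factor `2 / (1 - q)` (`norm_expOuter_average_le`). The fixed point contributes
the `1 / k` term and the summable transient the `1 / k²` term. The stated constants follow from `1 -
q = α p λ`, `λ ≥ (1 - p) min 𝕏_ii`, the bound `‖B‖ ≤ ‖E[Xᵀ Y Yᵀ X]‖ / λ²`, and an estimate of `S₀`
that loses no factor 2 (`norm_opS_zero_le`). -/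

theorem two_mul_dotProduct_mulVec_le (A : Matrix (Fin d) (Fin d) ℝ) (u v : Fin d → ℝ) :
    2 * (u ⬝ᵥ A *ᵥ v) ≤ ‖A‖ * (u ⬝ᵥ u + v ⬝ᵥ v) := by
  have h := real_inner_le_norm (WithLp.toLp 2 u)
    (Matrix.toEuclideanCLM (𝕜 := ℝ) A (WithLp.toLp 2 v))
  rw [Matrix.inner_toEuclideanCLM] at h
  have h2 := (Matrix.toEuclideanCLM (𝕜 := ℝ) A).le_opNorm (WithLp.toLp 2 v)
  rw [Matrix.l2_opNorm_toEuclideanCLM] at h2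
  have hu : u ⬝ᵥ u = ‖WithLp.toLp 2 u‖ ^ 2 := by
    rw [EuclideanSpace.real_norm_sq_eq]; simp [dotProduct, pow_two]
  have hv : v ⬝ᵥ v = ‖WithLp.toLp 2 v‖ ^ 2 := by
    rw [EuclideanSpace.real_norm_sq_eq]; simp [dotProduct, pow_two]
  rw [hu, hv]
  have h3 := mul_le_mul_of_nonneg_left h2 (norm_nonneg (WithLp.toLp 2 u))
  have h4 : (0 : ℝ) ≤ ‖A‖ * (‖WithLp.toLp 2 u‖ - ‖WithLp.toLp 2 v‖) ^ 2 := by positivity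
  simp only at h
  nlinarith

/-- Converse of the previous bound: test with `v` and `u = c⁻¹ A v`. Because the right-hand side is
additive in `u ⬝ᵥ u` and `v ⬝ᵥ v`, this characterization of the norm passes through sums and
integrals without a further use of Cauchy–Schwarz. -/
theorem norm_le_of_two_mul_dotProduct_mulVec_le {A : Matrix (Fin d) (Fin d) ℝ} {c : ℝ} (hc : 0 ≤ c)
    (h : ∀ u v : Fin d → ℝ, 2 * (u ⬝ᵥ A *ᵥ v) ≤ c * (u ⬝ᵥ u + v ⬝ᵥ v)) : ‖A‖ ≤ c := by
  rw [← Matrix.l2_opNorm_toEuclideanCLM]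
  refine ContinuousLinearMap.opNorm_le_bound _ hc fun x => ?_
  have hs (y : EuclideanSpace ℝ (Fin d)) : ‖y‖ ^ 2 = y.ofLp ⬝ᵥ y.ofLp := by
    rw [EuclideanSpace.real_norm_sq_eq]; simp [dotProduct, pow_two]
  refine abs_le_of_sq_le_sq' ?_ (by positivity) |>.2
  rw [mul_pow, hs, hs, Matrix.ofLp_toEuclideanCLM]
  set v := x.ofLp
  set w := A *ᵥ v with hw
  rcases hc.eq_or_lt with rfl | hc
  · have := h w v
    rw [← hw] at this
    linarith
  · have := h (c⁻¹ • w) v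
    rw [← hw] at this
    simp only [smul_dotProduct, dotProduct_smul, smul_eq_mul] at this
    have h2 := mul_le_mul_of_nonneg_left this hc.le
    have e1 : c * (2 * (c⁻¹ * (w ⬝ᵥ w))) = 2 * (w ⬝ᵥ w) := by field_simp
    have e2 : c * (c * (c⁻¹ * (c⁻¹ * (w ⬝ᵥ w)) + v ⬝ᵥ v)) = w ⬝ᵥ w + c ^ 2 * (v ⬝ᵥ v) := by
      field_simp
    linarith

theorem norm_transpose (A : Matrix (Fin d) (Fin d) ℝ) : ‖Aᵀ‖ = ‖A‖ := by
  rw [← Matrix.conjTranspose_eq_transpose_of_trivial, Matrix.l2_opNorm_conjTranspose]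

theorem dotProduct_mulVec_comm_of_isSymm {A : Matrix (Fin d) (Fin d) ℝ} (hA : A.IsSymm)
    (u v : Fin d → ℝ) : u ⬝ᵥ A *ᵥ v = v ⬝ᵥ A *ᵥ u := by
  rw [Matrix.dotProduct_mulVec, dotProduct_comm, ← Matrix.mulVec_transpose, hA.eq]

/-- The norm of a symmetric matrix is controlled by its quadratic form. -/
theorem norm_le_of_isSymm {A : Matrix (Fin d) (Fin d) ℝ} (hA : A.IsSymm) {c : ℝ} (hc : 0 ≤ c)
    (h : ∀ v : Fin d → ℝ, |v ⬝ᵥ A *ᵥ v| ≤ c * (v ⬝ᵥ v)) : ‖A‖ ≤ c := by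
  refine norm_le_of_two_mul_dotProduct_mulVec_le hc fun u v => ?_
  -- Polarization: the forms at `u + v` and `u - v` differ by `4 u ⬝ᵥ A v`, and the parallelogram
  -- law evaluates the sum of the two bounds.
  have h1 := (abs_le.1 (h (u + v))).2
  have h2 := (abs_le.1 (h (u - v))).1
  simp only [Matrix.mulVec_add, Matrix.mulVec_sub, dotProduct_add, add_dotProduct, dotProduct_sub,
    sub_dotProduct] at h1 h2
  have := dotProduct_mulVec_comm_of_isSymm hA u v
  have := dotProduct_comm u v
  linarith

theorem abs_apply_le_norm (A : Matrix (Fin d) (Fin d) ℝ) (i j : Fin d) : |A i j| ≤ ‖A‖ := by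
  have h1 := two_mul_dotProduct_mulVec_le A (Pi.single i 1) (Pi.single j 1)
  have h2 := two_mul_dotProduct_mulVec_le A (-Pi.single i 1) (Pi.single j 1)
  simp at h1 h2
  rw [abs_le]
  constructor <;> linarith

theorem quadForm_le (A : Matrix (Fin d) (Fin d) ℝ) (v : Fin d → ℝ) :
    v ⬝ᵥ A *ᵥ v ≤ ‖A‖ * (v ⬝ᵥ v) := by
  have := two_mul_dotProduct_mulVec_le A v v
  linarith

/-! ### Diagonal and off-diagonal parts -/

theorem diagPart_apply (A : Matrix (Fin d) (Fin d) ℝ) (i j : Fin d) :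
    diagPart A i j = if i = j then A i i else 0 := by
  simp [diagPart, Matrix.diagonal_apply]

theorem offDiag_apply (A : Matrix (Fin d) (Fin d) ℝ) (i j : Fin d) :
    offDiag A i j = if i = j then 0 else A i j := by
  rw [offDiag, Matrix.sub_apply, diagPart_apply]
  split_ifs with h
  · subst h; ring
  · ring

theorem pPart_apply (p : ℝ) (A : Matrix (Fin d) (Fin d) ℝ) (i j : Fin d) :
    pPart p A i j = if i = j then A i i else p * A i j := by
  simp only [pPart, Matrix.add_apply, Matrix.smul_apply, diagPart_apply, smul_eq_mul]
  split_ifs with h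
  · subst h; ring
  · ring

theorem norm_diagPart_le (A : Matrix (Fin d) (Fin d) ℝ) : ‖diagPart A‖ ≤ ‖A‖ := by
  rw [diagPart, Matrix.l2_opNorm_diagonal, pi_norm_le_iff_of_nonneg (norm_nonneg _)]
  exact fun i => abs_apply_le_norm A i i

theorem norm_pPart_le {p : ℝ} (hp0 : 0 ≤ p) (hp1 : p ≤ 1) (A : Matrix (Fin d) (Fin d) ℝ) :
    ‖pPart p A‖ ≤ ‖A‖ := by
  refine (norm_add_le _ _).trans ?_
  rw [norm_smul, norm_smul, Real.norm_of_nonneg hp0, Real.norm_of_nonneg (sub_nonneg.2 hp1)]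
  have := mul_le_mul_of_nonneg_left (norm_diagPart_le A) (sub_nonneg.2 hp1)
  linarith

theorem norm_offDiag_le_two_mul (A : Matrix (Fin d) (Fin d) ℝ) : ‖offDiag A‖ ≤ 2 * ‖A‖ := by
  have := norm_sub_le A (diagPart A)
  have := norm_diagPart_le A
  rw [offDiag]
  linarith

theorem isSymm_diagPart (A : Matrix (Fin d) (Fin d) ℝ) : (diagPart A).IsSymm :=
  Matrix.diagonal_transpose _

theorem isSymm_offDiag {A : Matrix (Fin d) (Fin d) ℝ} (hA : A.IsSymm) : (offDiag A).IsSymm :=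
  hA.sub (isSymm_diagPart A)

theorem isSymm_pPart (p : ℝ) {A : Matrix (Fin d) (Fin d) ℝ} (hA : A.IsSymm) :
    (pPart p A).IsSymm :=
  (hA.smul p).add ((isSymm_diagPart A).smul (1 - p))

/-! ### The Gram matrix -/

variable (X : Matrix (Fin n) (Fin d) ℝ)

theorem isSymm_gram : (gram X).IsSymm := by
  simp [Matrix.IsSymm, gram]

theorem quadForm_gram (v : Fin d → ℝ) : v ⬝ᵥ gram X *ᵥ v = (X *ᵥ v) ⬝ᵥ (X *ᵥ v) := by
  rw [gram, ← Matrix.mulVec_mulVec, Matrix.dotProduct_mulVec, Matrix.vecMul_transpose]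

theorem quadForm_gram_nonneg (v : Fin d → ℝ) : 0 ≤ v ⬝ᵥ gram X *ᵥ v := by
  rw [quadForm_gram]
  exact Finset.sum_nonneg fun i _ => mul_self_nonneg _

theorem gram_apply (i j : Fin d) : gram X i j = ∑ k, X k i * X k j := by
  simp [gram, Matrix.mul_apply]

theorem gram_diag_nonneg (i : Fin d) : 0 ≤ gram X i i := by
  rw [gram_apply]
  exact Finset.sum_nonneg fun k _ => mul_self_nonneg _

theorem gram_diag_pos {X : Matrix (Fin n) (Fin d) ℝ} (hX : ∀ j, X.col j ≠ 0) (i : Fin d) :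
    0 < gram X i i := by
  refine (gram_diag_nonneg X i).lt_of_ne fun h => hX i ?_
  rw [gram_apply, eq_comm, Finset.sum_eq_zero_iff_of_nonneg fun k _ => mul_self_nonneg _] at h
  ext k
  simpa using h k (Finset.mem_univ _)

theorem quadForm_diagPart (A : Matrix (Fin d) (Fin d) ℝ) (v : Fin d → ℝ) :
    v ⬝ᵥ diagPart A *ᵥ v = ∑ i, A i i * v i ^ 2 := by
  simp only [diagPart, dotProduct, Matrix.mulVec_diagonal, Matrix.diag_apply]
  exact Finset.sum_congr rfl fun i _ => by ring

/-- The Gram matrix and its diagonal part both have quadratic forms between 0 and `‖𝕏‖ |v|²`, so the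
form of their difference has absolute value at most `‖𝕏‖ |v|²`. Positivity is what improves the
general factor 2 to 1. -/
theorem norm_offDiag_gram_le : ‖offDiag (gram X)‖ ≤ ‖gram X‖ := by
  refine norm_le_of_isSymm (isSymm_offDiag (isSymm_gram X)) (norm_nonneg _) fun v => ?_
  have h1 := quadForm_le (gram X) v
  have h2 := quadForm_gram_nonneg X v
  have h3 : v ⬝ᵥ diagPart (gram X) *ᵥ v ≤ ‖gram X‖ * (v ⬝ᵥ v) :=
    (quadForm_le _ v).trans (mul_le_mul_of_nonneg_right (norm_diagPart_le _)
      (Finset.sum_nonneg fun i _ => mul_self_nonneg _))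
  have h4 : 0 ≤ v ⬝ᵥ diagPart (gram X) *ᵥ v := by
    rw [quadForm_diagPart]
    exact Finset.sum_nonneg fun i _ => mul_nonneg (gram_diag_nonneg X i) (sq_nonneg _)
  rw [offDiag, Matrix.sub_mulVec, dotProduct_sub, abs_le]
  constructor <;> linarith

theorem dotProduct_mulVec_eq_sum (A : Matrix (Fin d) (Fin d) ℝ) (u v : Fin d → ℝ) :
    u ⬝ᵥ A *ᵥ v = ∑ i, ∑ j, u i * A i j * v j := by
  simp [dotProduct, Matrix.mulVec, Finset.mul_sum, mul_assoc]

/-- Schur multiplication by a Gram matrix. -/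
theorem norm_hadamard_gram_le (A : Matrix (Fin d) (Fin d) ℝ) :
    ‖A ⊙ gram X‖ ≤ ‖gram X‖ * ‖A‖ := by
  refine norm_le_of_two_mul_dotProduct_mulVec_le (by positivity) fun u v => ?_
  -- With `X_k` the `k`-th row, `A ⊙ 𝕏` is the sum over `k` of `diag(X_k) A diag(X_k)`, while the
  -- squares `diag(X_k)²` add up to `Diag(𝕏)`.
  have hq (w : Fin d → ℝ) :
      ∑ k, (fun i => X k i * w i) ⬝ᵥ (fun i => X k i * w i) ≤ ‖gram X‖ * (w ⬝ᵥ w) := by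
    have : ∑ k, (fun i => X k i * w i) ⬝ᵥ (fun i => X k i * w i)
        = w ⬝ᵥ diagPart (gram X) *ᵥ w := by
      rw [quadForm_diagPart]
      simp only [dotProduct, gram_apply, Finset.sum_mul]
      rw [Finset.sum_comm]
      exact Finset.sum_congr rfl fun i _ => Finset.sum_congr rfl fun k _ => by ring
    rw [this]
    exact (quadForm_le _ w).trans (mul_le_mul_of_nonneg_right (norm_diagPart_le _)
      (Finset.sum_nonneg fun i _ => mul_self_nonneg _))
  have he : u ⬝ᵥ (A ⊙ gram X) *ᵥ v
      = ∑ k, (fun i => X k i * u i) ⬝ᵥ A *ᵥ (fun i => X k i * v i) := by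
    simp only [dotProduct_mulVec_eq_sum, Matrix.hadamard_apply, gram_apply, Finset.mul_sum,
      Finset.sum_mul]
    rw [Finset.sum_comm (s := (Finset.univ : Finset (Fin n)))]
    refine Finset.sum_congr rfl fun i _ => ?_
    rw [Finset.sum_comm (s := (Finset.univ : Finset (Fin n)))]
    exact Finset.sum_congr rfl fun j _ => Finset.sum_congr rfl fun k _ => by ring
  rw [he, Finset.mul_sum]
  calc ∑ k, 2 * ((fun i => X k i * u i) ⬝ᵥ A *ᵥ (fun i => X k i * v i))
      ≤ ∑ k, ‖A‖ * ((fun i => X k i * u i) ⬝ᵥ (fun i => X k i * u i)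
          + (fun i => X k i * v i) ⬝ᵥ (fun i => X k i * v i)) :=
        Finset.sum_le_sum fun k _ => two_mul_dotProduct_mulVec_le A _ _
    _ = ‖A‖ * (∑ k, (fun i => X k i * u i) ⬝ᵥ (fun i => X k i * u i)
          + ∑ k, (fun i => X k i * v i) ⬝ᵥ (fun i => X k i * v i)) := by
        rw [← Finset.mul_sum, Finset.sum_add_distrib]
    _ ≤ ‖A‖ * (‖gram X‖ * (u ⬝ᵥ u) + ‖gram X‖ * (v ⬝ᵥ v)) := by
        have := hq u
        have := hq v
        gcongr
    _ = _ := by ring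

end

section

/-! ### The smallest eigenvalue -/

theorem isHermitian_of_isSymm {A : Matrix (Fin d) (Fin d) ℝ} (hA : A.IsSymm) : A.IsHermitian := by
  rw [Matrix.IsHermitian, Matrix.conjTranspose_eq_transpose_of_trivial]; exact hA

/-- Subtracting `lambdaMin A` times the identity shifts the spectrum into the nonnegative half-line,
so the difference is positive semidefinite. -/
theorem lambdaMin_mul_le {A : Matrix (Fin d) (Fin d) ℝ} (hA : A.IsSymm) (v : Fin d → ℝ) :
    lambdaMin A * (v ⬝ᵥ v) ≤ v ⬝ᵥ A *ᵥ v := by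
  have hB : (A - lambdaMin A • (1 : Matrix (Fin d) (Fin d) ℝ)).IsHermitian :=
    isHermitian_of_isSymm (hA.sub (Matrix.isSymm_one.smul _))
  have hps := hB.posSemidef_iff_eigenvalues_nonneg.2 fun i => by
    have hi := hB.eigenvalues_mem_spectrum_real i
    generalize hB.eigenvalues i = e at hi
    rw [← Algebra.algebraMap_eq_smul_one, ← spectrum.sub_singleton_eq] at hi
    obtain ⟨x, hx, y, rfl, rfl⟩ := hi
    exact sub_nonneg.2 (csInf_le A.finite_real_spectrum.bddBelow hx)
  have := hps.dotProduct_mulVec_nonneg v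
  simp only [star_trivial, Matrix.sub_mulVec, dotProduct_sub, Matrix.smul_mulVec,
    Matrix.one_mulVec, dotProduct_smul, smul_eq_mul] at this
  linarith

theorem dotProduct_self_pos {v : Fin d → ℝ} (hv : v ≠ 0) : 0 < v ⬝ᵥ v := by
  refine (Finset.sum_nonneg fun i _ => mul_self_nonneg _).lt_of_ne fun h => hv ?_
  exact dotProduct_self_eq_zero.1 h.symm

theorem le_lambdaMin [Nonempty (Fin d)] {A : Matrix (Fin d) (Fin d) ℝ} (hA : A.IsSymm) {c : ℝ}
    (h : ∀ v : Fin d → ℝ, c * (v ⬝ᵥ v) ≤ v ⬝ᵥ A *ᵥ v) : c ≤ lambdaMin A := by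
  have hA' := isHermitian_of_isSymm hA
  rw [lambdaMin, hA'.spectrum_real_eq_range_eigenvalues]
  refine le_ciInf fun i => ?_
  have hne : (hA'.eigenvectorBasis i).ofLp ≠ 0 := by
    simpa using hA'.eigenvectorBasis.orthonormal.ne_zero i
  have := h (hA'.eigenvectorBasis i).ofLp
  rw [hA'.mulVec_eigenvectorBasis, dotProduct_smul, smul_eq_mul] at this
  exact le_of_mul_le_mul_right this (dotProduct_self_pos hne)

theorem lambdaMin_le_norm [Nonempty (Fin d)] {A : Matrix (Fin d) (Fin d) ℝ} (hA : A.IsSymm) :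
    lambdaMin A ≤ ‖A‖ := by
  obtain ⟨i⟩ := ‹Nonempty (Fin d)›
  have := (lambdaMin_mul_le hA (Pi.single i 1)).trans (quadForm_le A _)
  simpa using this

/-! ### The regularized Gram matrix -/

variable (X : Matrix (Fin n) (Fin d) ℝ)

theorem minDiag_le (A : Matrix (Fin d) (Fin d) ℝ) (i : Fin d) : minDiag A ≤ A i i :=
  ciInf_le (Set.finite_range _).bddBelow i

theorem minDiag_gram_pos [Nonempty (Fin d)] {X : Matrix (Fin n) (Fin d) ℝ}
    (hX : ∀ j, X.col j ≠ 0) : 0 < minDiag (gram X) := by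
  obtain ⟨i, hi⟩ := exists_eq_ciInf_of_finite (f := fun i => gram X i i)
  rw [minDiag, ← hi]
  exact gram_diag_pos hX i

theorem minDiag_mul_le_quadForm {p : ℝ} (hp0 : 0 ≤ p) (hp1 : p ≤ 1) (v : Fin d → ℝ) :
    (1 - p) * minDiag (gram X) * (v ⬝ᵥ v) ≤ v ⬝ᵥ pPart p (gram X) *ᵥ v := by
  have h1 : minDiag (gram X) * (v ⬝ᵥ v) ≤ v ⬝ᵥ diagPart (gram X) *ᵥ v := by
    rw [quadForm_diagPart, dotProduct, Finset.mul_sum]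
    refine Finset.sum_le_sum fun i _ => ?_
    rw [← pow_two]
    exact mul_le_mul_of_nonneg_right (minDiag_le _ i) (sq_nonneg _)
  have h2 := mul_nonneg hp0 (quadForm_gram_nonneg X v)
  have h3 := mul_le_mul_of_nonneg_left h1 (sub_nonneg.2 hp1)
  simp only [pPart, Matrix.add_mulVec, Matrix.smul_mulVec, dotProduct_add, dotProduct_smul,
    smul_eq_mul]
  linarith

theorem quadForm_pPart_pos {X : Matrix (Fin n) (Fin d) ℝ} (hX : ∀ j, X.col j ≠ 0) {p : ℝ}
    (hp0 : 0 ≤ p) (hp1 : p < 1) {v : Fin d → ℝ} (hv : v ≠ 0) :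
    0 < v ⬝ᵥ pPart p (gram X) *ᵥ v := by
  obtain ⟨i, -⟩ := Function.ne_iff.1 hv
  have : Nonempty (Fin d) := ⟨i⟩
  exact (mul_pos (mul_pos (sub_pos.2 hp1) (minDiag_gram_pos hX)) (dotProduct_self_pos hv)).trans_le
    (minDiag_mul_le_quadForm X hp0 hp1.le v)

theorem isUnit_pPart_gram {X : Matrix (Fin n) (Fin d) ℝ} (hX : ∀ j, X.col j ≠ 0) {p : ℝ}
    (hp0 : 0 ≤ p) (hp1 : p < 1) : IsUnit (pPart p (gram X)) := by
  rw [← Matrix.mulVec_injective_iff_isUnit, ← Matrix.coe_mulVecLin, ← LinearMap.ker_eq_bot,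
    LinearMap.ker_eq_bot']
  intro v hv
  by_contra hne
  have := quadForm_pPart_pos hX hp0 hp1 hne
  rw [Matrix.mulVecLin_apply] at hv
  simp [hv] at this

theorem pPart_gram_mulVec_betaTilde {X : Matrix (Fin n) (Fin d) ℝ} (hX : ∀ j, X.col j ≠ 0) {p : ℝ}
    (hp0 : 0 ≤ p) (hp1 : p < 1) (y : Fin n → ℝ) :
    pPart p (gram X) *ᵥ betaTilde p X y = Xᵀ *ᵥ y := by
  rw [betaTilde, Matrix.mulVec_mulVec, Matrix.mul_nonsing_inv _
    ((Matrix.isUnit_iff_isUnit_det _).1 (isUnit_pPart_gram hX hp0 hp1)), Matrix.one_mulVec]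

/-- The bound `a ‖𝕏‖ ≤ 1` keeps the matrix positive semidefinite, so only its largest eigenvalue
matters. -/
theorem norm_one_sub_smul_pPart_le [Nonempty (Fin d)] {a p : ℝ} (ha : 0 ≤ a) (hp0 : 0 ≤ p)
    (hp1 : p ≤ 1) (hag : a * ‖gram X‖ ≤ 1) :
    ‖1 - a • pPart p (gram X)‖ ≤ 1 - a * lambdaMin (pPart p (gram X)) := by
  have hs := isSymm_pPart p (isSymm_gram X)
  have hn := norm_pPart_le hp0 hp1 (gram X)
  refine norm_le_of_isSymm (Matrix.isSymm_one.sub (hs.smul a)) ?_ fun v => ?_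
  · have := mul_le_mul_of_nonneg_left ((lambdaMin_le_norm hs).trans hn) ha
    linarith
  · have hv : 0 ≤ v ⬝ᵥ v := Finset.sum_nonneg fun i _ => mul_self_nonneg _
    have h1 := mul_le_mul_of_nonneg_left (lambdaMin_mul_le hs v) ha
    have h2 := mul_le_mul_of_nonneg_left
      ((quadForm_le (pPart p (gram X)) v).trans (mul_le_mul_of_nonneg_right hn hv)) ha
    have h3 := mul_le_mul_of_nonneg_right hag hv
    simp only [Matrix.sub_mulVec, Matrix.one_mulVec, Matrix.smul_mulVec, dotProduct_sub,
      dotProduct_smul, smul_eq_mul]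
    rw [abs_of_nonneg (by linarith)]
    linarith

theorem norm_pPart_inv_le [Nonempty (Fin d)] {X : Matrix (Fin n) (Fin d) ℝ}
    (hX : ∀ j, X.col j ≠ 0) {p : ℝ} (hp0 : 0 ≤ p) (hp1 : p < 1) :
    ‖(pPart p (gram X))⁻¹‖ ≤ (lambdaMin (pPart p (gram X)))⁻¹ := by
  have hs := isSymm_pPart p (isSymm_gram X)
  set P := pPart p (gram X) with hP
  have hl : 0 < lambdaMin P := by
    refine lt_of_lt_of_le ?_ (le_lambdaMin hs (minDiag_mul_le_quadForm X hp0 hp1.le))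
    exact mul_pos (sub_pos.2 hp1) (minDiag_gram_pos hX)
  have hu := (Matrix.isUnit_iff_isUnit_det _).1 (isUnit_pPart_gram hX hp0 hp1)
  rw [← hP] at hu
  refine norm_le_of_isSymm (by rw [Matrix.IsSymm, Matrix.transpose_nonsing_inv, hs.eq])
    (by positivity) fun v => ?_
  set w := P⁻¹ *ᵥ v with hw
  have hv : v = P *ᵥ w := by
    rw [hw, Matrix.mulVec_mulVec, Matrix.mul_nonsing_inv _ hu, Matrix.one_mulVec]
  have h1 := lambdaMin_mul_le hs w
  rw [← hv] at h1
  have hww : 0 ≤ w ⬝ᵥ w := Finset.sum_nonneg fun i _ => mul_self_nonneg _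
  have h0 : 0 ≤ w ⬝ᵥ v := (mul_nonneg hl.le hww).trans h1
  -- With `v = P w` and `λ |w|² ≤ w ⬝ᵥ v`, expanding this square gives `|v|² ≥ 2 λ w ⬝ᵥ v - λ² |w|²
  -- ≥ λ w ⬝ᵥ v`.
  have h2 : 0 ≤ (v - lambdaMin P • w) ⬝ᵥ (v - lambdaMin P • w) :=
    Finset.sum_nonneg fun i _ => mul_self_nonneg _
  simp only [sub_dotProduct, dotProduct_sub, smul_dotProduct, dotProduct_smul, smul_eq_mul] at h2
  rw [dotProduct_comm v w] at h2 ⊢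
  rw [abs_of_nonneg h0, inv_mul_eq_div, le_div_iff₀ hl]
  have := mul_le_mul_of_nonneg_left h1 hl.le
  nlinarith

/-! ### Contraction -/

theorem norm_hadamard_gram_gram_le (A : Matrix (Fin d) (Fin d) ℝ) :
    ‖gram X ⊙ A ⊙ gram X‖ ≤ ‖gram X‖ ^ 2 * ‖A‖ := by
  rw [Matrix.hadamard_comm (gram X) A]
  calc _ ≤ ‖gram X‖ * ‖A ⊙ gram X‖ := norm_hadamard_gram_le X _
    _ ≤ ‖gram X‖ * (‖gram X‖ * ‖A‖) := by gcongr; exact norm_hadamard_gram_le X _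
    _ = _ := by ring

/-- Termwise triangle inequality. In the last bracket, 1 comes from the `diagPart` term, `2 p (1 -
p)` from the Hadamard term, where `offDiag A` costs a factor 2, and `3 p` from the three remaining
terms. -/
theorem norm_opS_linear_part_le {α p q : ℝ} (hp0 : 0 ≤ p) (hp1 : p ≤ 1)
    (hq : ‖1 - (α * p) • pPart p (gram X)‖ ≤ q) (A : Matrix (Fin d) (Fin d) ℝ) :
    ‖opS α p (gram X) 0 A‖ ≤
      (q ^ 2 + α ^ 2 * p * (1 - p) * (1 + 2 * p * (1 - p) + 3 * p) * ‖gram X‖ ^ 2) * ‖A‖ := by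
  have hp1' := sub_nonneg.2 hp1
  have hP := norm_pPart_le hp0 hp1 (gram X)
  have hO := norm_offDiag_gram_le X
  set G := gram X with hG
  set g := ‖G‖
  have hq0 : 0 ≤ q := (norm_nonneg _).trans hq
  have hg : 0 ≤ g := norm_nonneg _
  have t1 : ‖(1 - (α * p) • pPart p G) * A * (1 - (α * p) • pPart p G)‖ ≤ q ^ 2 * ‖A‖ :=
    (norm_mul_le_of_le (norm_mul_le_of_le hq le_rfl) hq).trans_eq (by ring)
  have t2 : ‖diagPart (pPart p G * A * pPart p G)‖ ≤ g ^ 2 * ‖A‖ :=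
    (norm_diagPart_le _).trans
      ((norm_mul_le_of_le (norm_mul_le_of_le hP le_rfl) hP).trans_eq (by ring))
  have t3 : ‖G ⊙ offDiag A ⊙ G‖ ≤ g ^ 2 * (2 * ‖A‖) :=
    (norm_hadamard_gram_gram_le X _).trans
      (mul_le_mul_of_nonneg_left (norm_offDiag_le_two_mul A) (sq_nonneg g))
  have t4 : ‖pPart p (offDiag G * diagPart A * offDiag G)‖ ≤ g ^ 2 * ‖A‖ :=
    (norm_pPart_le hp0 hp1 _).trans
      ((norm_mul_le_of_le (norm_mul_le_of_le hO (norm_diagPart_le A)) hO).trans_eq (by ring))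
  have t5' : ‖diagPart (pPart p G * A)‖ ≤ g * ‖A‖ :=
    (norm_diagPart_le _).trans (norm_mul_le_of_le hP le_rfl)
  have t5 : ‖offDiag G * diagPart (pPart p G * A)‖ ≤ g ^ 2 * ‖A‖ :=
    (norm_mul_le_of_le hO t5').trans_eq (by ring)
  have t6 : ‖diagPart (pPart p G * A) * offDiag G‖ ≤ g ^ 2 * ‖A‖ :=
    (norm_mul_le_of_le t5' hO).trans_eq (by ring)
  have c2 : 0 ≤ α ^ 2 * p * (1 - p) := by positivity
  have c3 : 0 ≤ α ^ 2 * p ^ 2 * (1 - p) ^ 2 := by positivity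
  have c4 : 0 ≤ α ^ 2 * p ^ 2 * (1 - p) := by positivity
  rw [opS, add_zero]
  calc _ ≤ q ^ 2 * ‖A‖ + α ^ 2 * p * (1 - p) * (g ^ 2 * ‖A‖)
        + α ^ 2 * p ^ 2 * (1 - p) ^ 2 * (g ^ 2 * (2 * ‖A‖))
        + α ^ 2 * p ^ 2 * (1 - p) * (g ^ 2 * ‖A‖ + g ^ 2 * ‖A‖ + g ^ 2 * ‖A‖) := by
        refine norm_add_le_of_le (norm_add_le_of_le (norm_add_le_of_le t1 ?_) ?_) ?_
        · rw [norm_smul, Real.norm_of_nonneg c2]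
          exact mul_le_mul_of_nonneg_left t2 c2
        · rw [norm_smul, Real.norm_of_nonneg c3]
          exact mul_le_mul_of_nonneg_left t3 c3
        · rw [norm_smul, Real.norm_of_nonneg c4]
          exact mul_le_mul_of_nonneg_left (norm_add_le_of_le (norm_add_le_of_le t4 t5) t6) c4
    _ = _ := by ring

/-- The linear part of `S` is a contraction. -/
theorem norm_opSLin_le {α p l : ℝ} (hα : 0 ≤ α) (hp0 : 0 ≤ p) (hp1 : p ≤ 1)
    (hq : ‖1 - (α * p) • pPart p (gram X)‖ ≤ 1 - α * p * l) (hl0 : 0 ≤ l) (hl : l ≤ ‖gram X‖)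
    (hα₂ : 3 * α * ‖gram X‖ ^ 2 ≤ l) (B A : Matrix (Fin d) (Fin d) ℝ) :
    ‖opSLin α p (gram X) B A‖ ≤ (1 - α * p * l) * ‖A‖ := by
  change ‖opS α p (gram X) B A - opS α p (gram X) B 0‖ ≤ _
  rw [opS_sub_zero]
  refine (norm_opS_linear_part_le X hp0 hp1 hq A).trans
    (mul_le_mul_of_nonneg_right ?_ (norm_nonneg A))
  set g := ‖gram X‖
  have hg0 : 0 ≤ g := norm_nonneg _
  -- With `s = α p l`, the factor is at most `1 - 2 s + s² + s (1 - p / 3)`. Since `α l ≤ 1 / 3`,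
  -- the term `s²` is at most `s p / 3`, which the `- p` kept in `3 - p` below absorbs exactly.
  have hαg : 3 * (α * l) ≤ 1 := by
    rcases hl0.eq_or_lt with h | h
    · rw [← h]; norm_num
    · have : 3 * α * l ^ 2 ≤ l := le_trans (by gcongr) hα₂
      nlinarith
  have hw : 0 ≤ (1 - p) * (1 + 2 * p * (1 - p) + 3 * p) := by
    have := sub_nonneg.2 hp1
    positivity
  have h1 : (1 - p) * (1 + 2 * p * (1 - p) + 3 * p) ≤ 3 - p := by
    nlinarith [sq_nonneg (2 * p - 1), mul_nonneg (sq_nonneg p) (sub_nonneg.2 hp1)]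
  have h2 : (α * p) * ((1 - p) * (1 + 2 * p * (1 - p) + 3 * p) * (α * g ^ 2))
      ≤ (α * p) * ((3 - p) * (l / 3)) := by
    have : 0 ≤ 3 - p := by linarith
    refine mul_le_mul_of_nonneg_left ?_ (by positivity)
    exact mul_le_mul h1 (by linarith) (by positivity) (by positivity)
  have h3 : (α * p * l) * (p * (3 * (α * l))) ≤ (α * p * l) * (p * 1) := by gcongr
  nlinarith

/-- A strict contraction fixes only 0, and on a finite-dimensional space injectivity suffices. -/
theorem isUnit_one_sub_opSLin {α p q : ℝ} {G B : Matrix (Fin d) (Fin d) ℝ} (hq : q < 1)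
    (h : ∀ A, ‖opSLin α p G B A‖ ≤ q * ‖A‖) : IsUnit (1 - opSLin α p G B) := by
  rw [LinearMap.isUnit_iff_ker_eq_bot, LinearMap.ker_eq_bot']
  intro A hA
  have hA' : opSLin α p G B A = A := by
    rw [LinearMap.sub_apply, Module.End.one_apply, sub_eq_zero] at hA
    exact hA.symm
  have := h A
  rw [hA'] at this
  by_contra hne
  have := norm_pos_iff.2 hne
  nlinarith

theorem limitMatrix_eq {α p q : ℝ} {G B : Matrix (Fin d) (Fin d) ℝ} (hq : q < 1)
    (h : ∀ A, ‖opSLin α p G B A‖ ≤ q * ‖A‖) :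
    limitMatrix α p G B = opSLin α p G B (limitMatrix α p G B) + opS α p G B 0 := by
  have h1 := Ring.mul_inverse_cancel _ (isUnit_one_sub_opSLin hq h)
  have h2 := congrArg (fun T : Module.End ℝ (Matrix (Fin d) (Fin d) ℝ) => T (opS α p G B 0)) h1
  simp only [Module.End.mul_apply, Module.End.one_apply, LinearMap.sub_apply] at h2
  exact sub_eq_iff_eq_add'.1 h2

theorem norm_limitMatrix_le {α p q : ℝ} {G B : Matrix (Fin d) (Fin d) ℝ} (hq : q < 1)
    (h : ∀ A, ‖opSLin α p G B A‖ ≤ q * ‖A‖) :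
    ‖limitMatrix α p G B‖ ≤ ‖opS α p G B 0‖ / (1 - q) := by
  rw [le_div_iff₀ (by linarith)]
  have := norm_add_le (opSLin α p G B (limitMatrix α p G B)) (opS α p G B 0)
  rw [← limitMatrix_eq hq h] at this
  have := h (limitMatrix α p G B)
  linarith

/-! ### The constant term of `S` -/

theorem abs_quadForm_le (B : Matrix (Fin d) (Fin d) ℝ) (w : Fin d → ℝ) :
    |w ⬝ᵥ B *ᵥ w| ≤ ‖B‖ * (w ⬝ᵥ w) := by
  rw [abs_le]
  have h := quadForm_le (-B) w
  rw [norm_neg, Matrix.neg_mulVec, dotProduct_neg] at h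
  exact ⟨by linarith, quadForm_le B w⟩

/-- The expression is the quadratic form of `B` at a vector supported on the two coordinates `i` and
`j`. -/
theorem abs_pair_quadForm_le {B : Matrix (Fin d) (Fin d) ℝ} (hB : B.IsSymm) {i j : Fin d}
    (hij : i ≠ j) (x y : ℝ) :
    |2 * (x * B i j * y) + x * B j j * x + y * B i i * y| ≤ ‖B‖ * (x ^ 2 + y ^ 2) := by
  have h := abs_quadForm_le B (Pi.single j x + Pi.single i y)
  have e1 : (Pi.single j x + Pi.single i y : Fin d → ℝ) ⬝ᵥ (Pi.single j x + Pi.single i y)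
      = x ^ 2 + y ^ 2 := by
    simp [hij, hij.symm]; ring
  have e2 : (Pi.single j x + Pi.single i y : Fin d → ℝ) ⬝ᵥ B *ᵥ (Pi.single j x + Pi.single i y)
      = 2 * (x * B i j * y) + x * B j j * x + y * B i i * y := by
    have := hB.apply i j
    simp [add_dotProduct, Matrix.mulVec_add, this]; ring
  rwa [e1, e2] at h

/-- With `H = offDiag G`, the quadratic form is the sum of `H_ij² (v_i B_ij v_j + v_i B_jj v_i)`.
Pairing `(i, j)` with `(j, i)` turns each bracket into the form of `B` at `v_i e_j + v_j e_i`, and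
the row sums of `H_ij²` are the diagonal entries of `H²`. Treating the Hadamard and diagonal parts
jointly avoids the factor lost by bounding them separately. -/
theorem norm_hadamard_add_diagPart_le {B G : Matrix (Fin d) (Fin d) ℝ} (hB : B.IsSymm)
    (hG : G.IsSymm) :
    ‖G ⊙ offDiag B ⊙ G + diagPart (offDiag G * diagPart B * offDiag G)‖
      ≤ ‖offDiag G‖ ^ 2 * ‖B‖ := by
  set H := offDiag G with hH
  have hHs : H.IsSymm := isSymm_offDiag hG
  have hHd (i : Fin d) : H i i = 0 := by simp [hH, offDiag_apply]
  have hent (i j : Fin d) : (G ⊙ offDiag B ⊙ G) i j = H i j ^ 2 * B i j := by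
    simp only [Matrix.hadamard_apply, hH, offDiag_apply]
    split_ifs <;> ring
  have hdiag (i : Fin d) : (H * diagPart B * H) i i = ∑ j, H i j ^ 2 * B j j := by
    rw [Matrix.mul_apply]
    simp only [diagPart, Matrix.mul_diagonal, Matrix.diag_apply]
    exact Finset.sum_congr rfl fun j _ => by rw [hHs.apply i j]; ring
  have hrow (i : Fin d) : ∑ j, H i j ^ 2 ≤ ‖H‖ ^ 2 := by
    have h1 := (le_abs_self _).trans (abs_apply_le_norm (H * H) i i)
    have h2 := norm_mul_le H H
    rw [Matrix.mul_apply] at h1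
    calc ∑ j, H i j ^ 2 = ∑ j, H i j * H j i :=
          Finset.sum_congr rfl fun j _ => by rw [hHs.apply i j]; ring
      _ ≤ ‖H‖ ^ 2 := by rw [pow_two]; exact h1.trans h2
  refine norm_le_of_isSymm ?_ (by positivity) fun v => ?_
  · refine Matrix.IsSymm.add ?_ (isSymm_diagPart _)
    ext i j
    rw [Matrix.transpose_apply, hent, hent, hHs.apply i j, hB.apply i j]
  have e1 : v ⬝ᵥ (G ⊙ offDiag B ⊙ G + diagPart (H * diagPart B * H)) *ᵥ v
      = ∑ i, ∑ j, H i j ^ 2 * (v i * B i j * v j + v i * B j j * v i) := by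
    rw [Matrix.add_mulVec, dotProduct_add, quadForm_diagPart, dotProduct_mulVec_eq_sum,
      ← Finset.sum_add_distrib]
    refine Finset.sum_congr rfl fun i _ => ?_
    rw [hdiag, Finset.sum_mul, ← Finset.sum_add_distrib]
    exact Finset.sum_congr rfl fun j _ => by rw [hent]; ring
  have e2 : 2 * (v ⬝ᵥ (G ⊙ offDiag B ⊙ G + diagPart (H * diagPart B * H)) *ᵥ v)
      = ∑ i, ∑ j, H i j ^ 2 *
        (2 * (v i * B i j * v j) + v i * B j j * v i + v j * B i i * v j) := by
    have e3 := e1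
    rw [Finset.sum_comm] at e3
    rw [two_mul]
    nth_rw 1 [e1]
    rw [e3, ← Finset.sum_add_distrib]
    refine Finset.sum_congr rfl fun i _ => ?_
    rw [← Finset.sum_add_distrib]
    exact Finset.sum_congr rfl fun j _ => by rw [hHs.apply i j, hB.apply i j]; ring
  have h3 : |2 * (v ⬝ᵥ (G ⊙ offDiag B ⊙ G + diagPart (H * diagPart B * H)) *ᵥ v)|
      ≤ ∑ i, ∑ j, H i j ^ 2 * (‖B‖ * (v i ^ 2 + v j ^ 2)) := by
    rw [e2]
    refine (Finset.abs_sum_le_sum_abs _ _).trans (Finset.sum_le_sum fun i _ => ?_)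
    refine (Finset.abs_sum_le_sum_abs _ _).trans (Finset.sum_le_sum fun j _ => ?_)
    rcases eq_or_ne i j with rfl | hij
    · simp [hHd]
    · rw [abs_mul, abs_of_nonneg (sq_nonneg (H i j))]
      exact mul_le_mul_of_nonneg_left (abs_pair_quadForm_le hB hij _ _) (sq_nonneg _)
  have h4 : ∑ i, ∑ j, H i j ^ 2 * (‖B‖ * (v i ^ 2 + v j ^ 2))
      = 2 * (‖B‖ * ∑ i, (∑ j, H i j ^ 2) * v i ^ 2) := by
    have s1 : ∑ i, ∑ j, H i j ^ 2 * v j ^ 2 = ∑ i, (∑ j, H i j ^ 2) * v i ^ 2 := by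
      rw [Finset.sum_comm]
      refine Finset.sum_congr rfl fun i _ => ?_
      rw [Finset.sum_mul]
      exact Finset.sum_congr rfl fun j _ => by rw [hHs.apply i j]
    have s2 : ∑ i, ∑ j, H i j ^ 2 * v i ^ 2 = ∑ i, (∑ j, H i j ^ 2) * v i ^ 2 := by
      simp only [Finset.sum_mul]
    rw [two_mul]
    nth_rw 1 [← s1]
    rw [← s2, ← mul_add, ← Finset.sum_add_distrib, Finset.mul_sum]
    refine Finset.sum_congr rfl fun i _ => ?_
    rw [← Finset.sum_add_distrib, Finset.mul_sum]
    exact Finset.sum_congr rfl fun j _ => by ring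
  have h5 : ∑ i, (∑ j, H i j ^ 2) * v i ^ 2 ≤ ‖H‖ ^ 2 * (v ⬝ᵥ v) := by
    rw [dotProduct, Finset.mul_sum]
    refine Finset.sum_le_sum fun i _ => ?_
    rw [← pow_two]
    exact mul_le_mul_of_nonneg_right (hrow i) (sq_nonneg _)
  rw [h4, abs_mul, abs_two] at h3
  have h6 := mul_le_mul_of_nonneg_left h5 (norm_nonneg B)
  linarith

theorem norm_opS_zero_le {α p : ℝ} (hp0 : 0 ≤ p) (hp1 : p ≤ 1) {B : Matrix (Fin d) (Fin d) ℝ}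
    (hB : B.IsSymm) :
    ‖opS α p (gram X) B 0‖ ≤ α ^ 2 * p ^ 2 * (1 - p) * (‖gram X‖ ^ 2 * ‖B‖) := by
  have hp1' := sub_nonneg.2 hp1
  have hO := norm_offDiag_gram_le X
  have h1 := norm_hadamard_add_diagPart_le hB (isSymm_gram X)
  set G := gram X
  have h2 : ‖G ⊙ offDiag B ⊙ G + diagPart (offDiag G * diagPart B * offDiag G)‖
      ≤ ‖G‖ ^ 2 * ‖B‖ := h1.trans (by gcongr)
  have h3 : ‖offDiag G * diagPart B * offDiag G‖ ≤ ‖G‖ ^ 2 * ‖B‖ :=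
    (norm_mul_le_of_le (norm_mul_le_of_le hO (norm_diagPart_le B)) hO).trans_eq (by ring)
  -- The diagonal share of `pPart` is moved to the Hadamard term. What remains is a convex
  -- combination of two matrices, each of norm at most `‖G‖² ‖B‖`.
  have e : opS α p G B 0 = (α ^ 2 * p ^ 2 * (1 - p)) •
      ((1 - p) • (G ⊙ offDiag B ⊙ G + diagPart (offDiag G * diagPart B * offDiag G))
        + p • (offDiag G * diagPart B * offDiag G)) := by
    rw [opS_zero, pPart]
    module
  rw [e, norm_smul, Real.norm_of_nonneg (by positivity)]
  refine mul_le_mul_of_nonneg_left ?_ (by positivity)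
  refine (norm_add_le _ _).trans ?_
  rw [norm_smul, norm_smul, Real.norm_of_nonneg hp0, Real.norm_of_nonneg hp1']
  have := mul_le_mul_of_nonneg_left h2 hp1'
  have := mul_le_mul_of_nonneg_left h3 hp0
  linarith

end

/-! ### Moments of a dropout matrix -/

/-- Conditional probability that coordinate `a` is kept, given that `i` and `j` are kept. -/
def keepProb (p : ℝ) (i j a : Fin d) : ℝ := if a = i ∨ a = j then 1 else p

/-- The fourth mixed moment of the diagonal entries `i, j, a, b` of a dropout matrix. -/
def dropMoment (p : ℝ) (i j a b : Fin d) : ℝ :=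
  (if i = j then p else p ^ 2) *
    (keepProb p i j a * keepProb p i j b
      + if a = b then keepProb p i j a * (1 - keepProb p i j a) else 0)

/-- Given that `i` and `j` are kept, the entries `a` and `b` are conditionally independent unless `a
= b`, in which case the conditional variance is added. This form separates `a` from `b`, as needed
to sum against a matrix. -/
theorem pow_card_eq_dropMoment (p : ℝ) (i j a b : Fin d) :
    p ^ ({i, j, a, b} : Finset (Fin d)).card = dropMoment p i j a b := by
  unfold dropMoment keepProb
  by_cases h1 : i = j <;> by_cases h2 : i = a <;> by_cases h3 : i = b <;> by_cases h4 : j = a <;>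
    by_cases h5 : j = b <;> by_cases h6 : a = b <;>
    simp_all [Finset.card_insert_of_notMem, eq_comm] <;> ring

namespace IsDropoutMatrix

variable {μ : Measure Ω} {p : unitInterval} {D : Ω → Matrix (Fin d) (Fin d) ℝ}

theorem eq_diagonal (hD : IsDropoutMatrix μ p D) (ω : Ω) :
    D ω = Matrix.diagonal (D ω).diag := ((hD.isDiag ω).diagonal_diag).symm

theorem measurable_diag (hD : IsDropoutMatrix μ p D) : Measurable fun ω => (D ω).diag :=
  measurable_pi_lambda _ hD.measurable

theorem ae_zero_or_one (hD : IsDropoutMatrix μ p D) :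
    ∀ᵐ ω ∂μ, ∀ i, (D ω).diag i = 0 ∨ (D ω).diag i = 1 := by
  rw [ae_all_iff]
  intro i
  have hs : MeasurableSet {x : ℝ | x = 0 ∨ x = 1} := by
    have : {x : ℝ | x = 0 ∨ x = 1} = {0, 1} := by ext; simp
    rw [this]
    exact (Set.toFinite _).measurableSet
  have h : ∀ᵐ x ∂(μ.map fun ω => D ω i i), x = 0 ∨ x = 1 := by
    rw [hD.law i, ae_iff]
    have := bernoulliMeasure_apply_of_notMem_of_notMem (x := (1 : ℝ)) (y := 0) p
      (s := {x : ℝ | ¬ (x = 0 ∨ x = 1)}) hs.compl (by simp) (by simp)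
    exact this
  exact ae_of_ae_map (hD.measurable i).aemeasurable h

theorem ae_sq (hD : IsDropoutMatrix μ p D) :
    ∀ᵐ ω ∂μ, ∀ i, (D ω).diag i * (D ω).diag i = (D ω).diag i := by
  filter_upwards [hD.ae_zero_or_one] with ω h i
  rcases h i with h | h <;> simp [-Matrix.diag_apply, h]

theorem integral_diag (hD : IsDropoutMatrix μ p D) (i : Fin d) :
    ∫ ω, D ω i i ∂μ = p := by
  have := integral_map (hD.measurable i).aemeasurable (μ := μ) (f := id)
    aestronglyMeasurable_id
  rw [hD.law i, integral_bernoulliMeasure] at this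
  simpa using this.symm

theorem integral_prod_diag (hD : IsDropoutMatrix μ p D) (s : Finset (Fin d)) :
    ∫ ω, ∏ i ∈ s, D ω i i ∂μ = (p : ℝ) ^ s.card := by
  have h := hD.indep.precomp (g := fun i : s => (i : Fin d)) Subtype.val_injective
  have h2 := h.integral_fun_prod_eq_prod_integral
    fun i => (hD.measurable i).aestronglyMeasurable
  simp only [hD.integral_diag, Finset.prod_const, Finset.card_univ,
    Fintype.card_coe] at h2
  rw [← h2]
  refine integral_congr_ae (ae_of_all _ fun ω => ?_)
  exact (Finset.prod_coe_sort s fun i => D ω i i).symm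

theorem integral_mul_diag (hD : IsDropoutMatrix μ p D) (i j a b : Fin d) :
    ∫ ω, (D ω).diag i * (D ω).diag j * (D ω).diag a * (D ω).diag b ∂μ = dropMoment p i j a b := by
  rw [← pow_card_eq_dropMoment, ← hD.integral_prod_diag]
  refine integral_congr_ae ?_
  filter_upwards [hD.ae_zero_or_one] with ω h
  simp only [Matrix.diag_apply] at h ⊢
  -- For entries in {0, 1} a repeated factor changes nothing, so the product with repetitions equals
  -- the product over the set of indices.
  have hins (k : Fin d) (s : Finset (Fin d)) :
      ∏ l ∈ insert k s, D ω l l = D ω k k * ∏ l ∈ s, D ω l l := by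
    by_cases hk : k ∈ s
    · rw [Finset.insert_eq_of_mem hk, ← Finset.mul_prod_erase s _ hk]
      rcases h k with h | h <;> simp [h]
    · exact Finset.prod_insert hk
  rw [hins, hins, hins, Finset.prod_singleton]
  ring

theorem integrable_mul_diag [IsProbabilityMeasure μ] (hD : IsDropoutMatrix μ p D)
    (i j a b : Fin d) :
    Integrable (fun ω => (D ω).diag i * (D ω).diag j * (D ω).diag a * (D ω).diag b) μ := by
  refine Integrable.of_bound ?_ 1 ?_
  · have := hD.measurable
    exact Measurable.aestronglyMeasurable (by
      simp only [Matrix.diag_apply]; fun_prop)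
  · filter_upwards [hD.ae_zero_or_one] with ω h
    rcases h i with h1 | h1 <;> rcases h j with h2 | h2 <;> rcases h a with h3 | h3 <;>
      rcases h b with h4 | h4 <;> simp [-Matrix.diag_apply, h1, h2, h3, h4]

end IsDropoutMatrix

/-! ### The random recursion matrices -/

/-- `1 - α D G D` for the diagonal matrix `D` with diagonal `x`. -/
def stepMat (α : ℝ) (G : Matrix (Fin d) (Fin d) ℝ) (x : Fin d → ℝ) : Matrix (Fin d) (Fin d) ℝ :=
  1 - α • (Matrix.diagonal x * G * Matrix.diagonal x)

/-- `α D (G - Diag G) (p - D)` for the diagonal matrix `D` with diagonal `x`. -/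
def noiseMat (α p : ℝ) (G : Matrix (Fin d) (Fin d) ℝ) (x : Fin d → ℝ) :
    Matrix (Fin d) (Fin d) ℝ :=
  α • (Matrix.diagonal x * offDiag G * (p • (1 : Matrix (Fin d) (Fin d) ℝ) - Matrix.diagonal x))

theorem stepMat_apply (α : ℝ) (G : Matrix (Fin d) (Fin d) ℝ) (x : Fin d → ℝ) (i a : Fin d) :
    stepMat α G x i a = (1 : Matrix (Fin d) (Fin d) ℝ) i a - α * (x i * G i a * x a) := by
  simp [stepMat, Matrix.mul_diagonal, Matrix.diagonal_mul]

theorem noiseMat_apply (α p : ℝ) (G : Matrix (Fin d) (Fin d) ℝ) (x : Fin d → ℝ) (i a : Fin d) :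
    noiseMat α p G x i a = α * (x i * offDiag G i a * (p - x a)) := by
  have : p • (1 : Matrix (Fin d) (Fin d) ℝ) - Matrix.diagonal x
      = Matrix.diagonal fun a => p - x a := by
    rw [Matrix.smul_one_eq_diagonal, Matrix.diagonal_sub]
  rw [noiseMat, this]
  simp [Matrix.mul_diagonal, Matrix.diagonal_mul]

theorem measurable_stepMat (α : ℝ) (G : Matrix (Fin d) (Fin d) ℝ) (i a : Fin d) :
    Measurable fun x => stepMat α G x i a := by
  simp only [stepMat_apply]
  fun_prop

theorem measurable_noiseMat (α p : ℝ) (G : Matrix (Fin d) (Fin d) ℝ) (i a : Fin d) :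
    Measurable fun x => noiseMat α p G x i a := by
  simp only [noiseMat_apply]
  fun_prop

theorem norm_diagonal_le_one {x : Fin d → ℝ} (hx : ∀ i, x i = 0 ∨ x i = 1) :
    ‖Matrix.diagonal x‖ ≤ 1 := by
  rw [Matrix.l2_opNorm_diagonal, pi_norm_le_iff_of_nonneg zero_le_one]
  intro i
  rcases hx i with h | h <;> simp [h]

theorem norm_stepMat_le {α : ℝ} (hα : 0 ≤ α) (G : Matrix (Fin d) (Fin d) ℝ) {x : Fin d → ℝ}
    (hx : ∀ i, x i = 0 ∨ x i = 1) : ‖stepMat α G x‖ ≤ 1 + α * ‖G‖ := by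
  have h1 := norm_diagonal_le_one hx
  have h0 : ‖(1 : Matrix (Fin d) (Fin d) ℝ)‖ ≤ 1 := by
    rw [← Matrix.diagonal_one, Matrix.l2_opNorm_diagonal, pi_norm_le_iff_of_nonneg zero_le_one]
    simp
  refine norm_sub_le_of_le h0 ?_
  rw [norm_smul, Real.norm_of_nonneg hα]
  refine mul_le_mul_of_nonneg_left ?_ hα
  exact (norm_mul_le_of_le (norm_mul_le_of_le h1 le_rfl) h1).trans_eq (by ring)

theorem norm_noiseMat_le {α p : ℝ} (hα : 0 ≤ α) (hp0 : 0 ≤ p) (hp1 : p ≤ 1)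
    (G : Matrix (Fin d) (Fin d) ℝ) {x : Fin d → ℝ}
    (hx : ∀ i, x i = 0 ∨ x i = 1) : ‖noiseMat α p G x‖ ≤ α * ‖offDiag G‖ := by
  have h1 := norm_diagonal_le_one hx
  have h2 : ‖p • (1 : Matrix (Fin d) (Fin d) ℝ) - Matrix.diagonal x‖ ≤ 1 := by
    rw [Matrix.smul_one_eq_diagonal, Matrix.diagonal_sub, Matrix.l2_opNorm_diagonal,
      pi_norm_le_iff_of_nonneg zero_le_one]
    intro i
    rw [Real.norm_eq_abs, abs_le]
    rcases hx i with h | h <;> simp only [h] <;> constructor <;> linarith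
  rw [noiseMat, norm_smul, Real.norm_of_nonneg hα]
  refine mul_le_mul_of_nonneg_left ?_ hα
  exact (norm_mul_le_of_le (norm_mul_le_of_le h1 le_rfl) h2).trans_eq (by ring)

namespace IsDropoutMatrix

variable {μ : Measure Ω} [IsProbabilityMeasure μ] {p : unitInterval}
  {D : Ω → Matrix (Fin d) (Fin d) ℝ}

theorem integral_stepMat (hD : IsDropoutMatrix μ p D) (α : ℝ) (G : Matrix (Fin d) (Fin d) ℝ)
    (i a : Fin d) :
    ∫ ω, stepMat α G (D ω).diag i a ∂μ
      = (1 - (α * p) • pPart p G : Matrix (Fin d) (Fin d) ℝ) i a := by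
  -- Idempotence of the entries lets lower moments be padded to fourth moments, so a single moment
  -- formula serves throughout.
  have h : (fun ω => stepMat α G (D ω).diag i a) =ᵐ[μ] fun ω =>
      (1 : Matrix (Fin d) (Fin d) ℝ) i a
        - α * G i a * ((D ω).diag i * (D ω).diag i * (D ω).diag a * (D ω).diag a) := by
    filter_upwards [hD.ae_sq] with ω h
    rw [stepMat_apply, h i, mul_assoc ((D ω).diag i) ((D ω).diag a), h a]
    ring
  rw [integral_congr_ae h, integral_sub (integrable_const _)
    ((hD.integrable_mul_diag _ _ _ _).const_mul _), integral_const_mul, hD.integral_mul_diag]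
  simp only [integral_const, probReal_univ, Matrix.sub_apply, Matrix.smul_apply,
    pPart_apply, dropMoment, keepProb, smul_eq_mul]
  by_cases hia : i = a
  · subst hia; simp; ring
  · simp [hia, Ne.symm hia]; ring

theorem integral_noiseMat (hD : IsDropoutMatrix μ p D) (α : ℝ) (G : Matrix (Fin d) (Fin d) ℝ)
    (i a : Fin d) :
    ∫ ω, noiseMat α p G (D ω).diag i a ∂μ = 0 := by
  have h : (fun ω => noiseMat α p G (D ω).diag i a) =ᵐ[μ] fun ω =>
      α * offDiag G i a * p * ((D ω).diag i * (D ω).diag i * (D ω).diag i * (D ω).diag i)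
        - α * offDiag G i a * ((D ω).diag i * (D ω).diag i * (D ω).diag a * (D ω).diag a) := by
    filter_upwards [hD.ae_sq] with ω h
    rw [noiseMat_apply, h i, h i, h i, mul_assoc ((D ω).diag i) ((D ω).diag a), h a]
    ring
  rw [integral_congr_ae h, integral_sub ((hD.integrable_mul_diag _ _ _ _).const_mul _)
    ((hD.integrable_mul_diag _ _ _ _).const_mul _), integral_const_mul, integral_const_mul,
    hD.integral_mul_diag, hD.integral_mul_diag]
  simp only [offDiag_apply, dropMoment, keepProb]
  by_cases hia : i = a
  · subst hia; simp
  · simp [hia, Ne.symm hia]; ring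

theorem integral_stepMat_mul_stepMat (hD : IsDropoutMatrix μ p D) (α : ℝ)
    (G : Matrix (Fin d) (Fin d) ℝ) (i j a b : Fin d) :
    ∫ ω, stepMat α G (D ω).diag i a * stepMat α G (D ω).diag j b ∂μ
      = (1 : Matrix (Fin d) (Fin d) ℝ) i a * (1 : Matrix (Fin d) (Fin d) ℝ) j b
        - (1 : Matrix (Fin d) (Fin d) ℝ) j b * (α * p * pPart p G i a)
        - (1 : Matrix (Fin d) (Fin d) ℝ) i a * (α * p * pPart p G j b)
        + α ^ 2 * (G i a * G j b * dropMoment p i j a b) := by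
  have hi (i a : Fin d) : Integrable (fun ω => stepMat α G (D ω).diag i a) μ := by
    refine Integrable.of_bound ?_ (1 + |α * G i a|) ?_
    · exact ((measurable_stepMat α G i a).comp hD.measurable_diag).aestronglyMeasurable
    · filter_upwards [hD.ae_zero_or_one] with ω h
      rw [stepMat_apply]
      refine norm_sub_le_of_le ?_ ?_
      · rw [Matrix.one_apply]; split_ifs <;> simp
      · rcases h i with h1 | h1 <;> rcases h a with h2 | h2 <;> simp [-Matrix.diag_apply, h1, h2] <;> positivity
  have h : (fun ω => stepMat α G (D ω).diag i a * stepMat α G (D ω).diag j b) = fun ω =>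
      (1 : Matrix (Fin d) (Fin d) ℝ) j b * stepMat α G (D ω).diag i a
        + (1 : Matrix (Fin d) (Fin d) ℝ) i a * stepMat α G (D ω).diag j b
        - (1 : Matrix (Fin d) (Fin d) ℝ) i a * (1 : Matrix (Fin d) (Fin d) ℝ) j b
        + α ^ 2 * (G i a * G j b) *
          ((D ω).diag i * (D ω).diag j * (D ω).diag a * (D ω).diag b) := by
    funext ω
    rw [stepMat_apply, stepMat_apply]
    ring
  have i1 := (hi i a).const_mul ((1 : Matrix (Fin d) (Fin d) ℝ) j b)
  have i2 := (hi j b).const_mul ((1 : Matrix (Fin d) (Fin d) ℝ) i a)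
  have i3 := (hD.integrable_mul_diag i j a b).const_mul (α ^ 2 * (G i a * G j b))
  rw [h, integral_add ?_ i3, integral_sub ?_ (integrable_const _), integral_add i1 i2,
    integral_const_mul, integral_const_mul, integral_const_mul, integral_const_mul,
    hD.integral_mul_diag, hD.integral_stepMat, hD.integral_stepMat]
  rotate_left
  · exact i1.add i2
  · exact (i1.add i2).sub (integrable_const _)
  simp only [integral_const, probReal_univ, Matrix.sub_apply, Matrix.smul_apply, smul_eq_mul]
  ring

theorem integral_noiseMat_mul_noiseMat (hD : IsDropoutMatrix μ p D) (α : ℝ)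
    (G : Matrix (Fin d) (Fin d) ℝ) (i j a b : Fin d) :
    ∫ ω, noiseMat α p G (D ω).diag i a * noiseMat α p G (D ω).diag j b ∂μ
      = α ^ 2 * (offDiag G i a * offDiag G j b * ((if i = j then (p : ℝ) else p ^ 2) *
        ((p - keepProb p i j a) * (p - keepProb p i j b)
          + if a = b then keepProb p i j a * (1 - keepProb p i j a) else 0))) := by
  have h : (fun ω => noiseMat α p G (D ω).diag i a * noiseMat α p G (D ω).diag j b) =ᵐ[μ]
      fun ω => α ^ 2 * (offDiag G i a * offDiag G j b) *
        (p ^ 2 * ((D ω).diag i * (D ω).diag j * (D ω).diag i * (D ω).diag j)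
          - p * ((D ω).diag i * (D ω).diag j * (D ω).diag a * (D ω).diag i)
          - p * ((D ω).diag i * (D ω).diag j * (D ω).diag b * (D ω).diag i)
          + ((D ω).diag i * (D ω).diag j * (D ω).diag a * (D ω).diag b)) := by
    filter_upwards [hD.ae_sq] with ω h
    rw [noiseMat_apply, noiseMat_apply]
    linear_combination (- α ^ 2 * (offDiag G i a * offDiag G j b) *
      (p ^ 2 * (D ω).diag j * (D ω).diag j - p * (D ω).diag j * (D ω).diag a
        - p * (D ω).diag j * (D ω).diag b)) * h i
      - α ^ 2 * (offDiag G i a * offDiag G j b) * p ^ 2 * (D ω).diag i * h j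
  have hi := hD.integrable_mul_diag
  have i1 := (hi i j i j).const_mul ((p : ℝ) ^ 2)
  have i2 := (hi i j a i).const_mul (p : ℝ)
  have i3 := (hi i j b i).const_mul (p : ℝ)
  rw [integral_congr_ae h, integral_const_mul, integral_add ?_ (hi i j a b),
    integral_sub ?_ i3, integral_sub i1 i2]
  rotate_left
  · exact i1.sub i2
  · exact (i1.sub i2).sub i3
  simp only [integral_const_mul, hD.integral_mul_diag]
  have k1 : keepProb (p : ℝ) i j i = 1 := by simp [keepProb]
  have k2 : keepProb (p : ℝ) i j j = 1 := by simp [keepProb]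
  have ite1 (a : Fin d) : (if a = i then keepProb (p : ℝ) i j a * (1 - keepProb p i j a) else 0)
      = 0 := by
    split_ifs with h
    · rw [h, k1]; ring
    · rfl
  simp only [dropMoment, k1, k2, ite1]
  have ite2 : (if i = j then (1 : ℝ) * (1 - 1) else 0) = 0 := by simp
  rw [ite2]
  ring

end IsDropoutMatrix

/-! ### Identification of the operator `S` -/

/-- Starting from probability `p` for every index, the value 1 at `a = i` is already built into
`pPart`, and the value 1 at `a = j` gives the correction term. -/
theorem mul_keepProb {p : ℝ} {G : Matrix (Fin d) (Fin d) ℝ} (i j a : Fin d) :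
    G i a * keepProb p i j a
      = pPart p G i a + (1 - p) * offDiag G i j * (1 : Matrix (Fin d) (Fin d) ℝ) j a := by
  simp only [keepProb, pPart_apply, offDiag_apply, Matrix.one_apply]
  by_cases h1 : i = a <;> by_cases h2 : j = a <;> by_cases h3 : i = j <;>
    simp_all [eq_comm] <;> ring

/-- The difference `p - keepProb` vanishes outside `{i, j}`, and `offDiag` removes `a = i`. -/
theorem offDiag_mul_sub_keepProb {p : ℝ} {G : Matrix (Fin d) (Fin d) ℝ} (i j a : Fin d) :
    offDiag G i a * (p - keepProb p i j a)
      = - ((1 - p) * offDiag G i j) * (1 : Matrix (Fin d) (Fin d) ℝ) j a := by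
  simp only [keepProb, offDiag_apply, Matrix.one_apply]
  by_cases h1 : i = a <;> by_cases h2 : j = a <;> by_cases h3 : i = j <;>
    simp_all [eq_comm]
  ring

theorem keepProb_comm (p : ℝ) (i j a : Fin d) : keepProb p i j a = keepProb p j i a := by
  simp [keepProb, or_comm]

/-- The conditional variance is zero for a kept index and `p (1 - p)` otherwise, so it restricts `G`
to its off-diagonal entries. -/
theorem mul_mul_keepProb_var {p : ℝ} {G : Matrix (Fin d) (Fin d) ℝ} (i j a : Fin d) :
    G i a * G j a * (keepProb p i j a * (1 - keepProb p i j a))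
      = p * (1 - p) * (offDiag G i a * offDiag G j a) := by
  simp only [keepProb, offDiag_apply]
  by_cases h1 : i = a <;> by_cases h2 : j = a <;> simp_all [eq_comm]
  ring

theorem offDiag_mul_offDiag_mul_keepProb_var {p : ℝ} {G : Matrix (Fin d) (Fin d) ℝ}
    (i j a : Fin d) :
    offDiag G i a * offDiag G j a * (keepProb p i j a * (1 - keepProb p i j a))
      = p * (1 - p) * (offDiag G i a * offDiag G j a) := by
  simp only [keepProb, offDiag_apply]
  by_cases h1 : i = a <;> by_cases h2 : j = a <;> simp_all [eq_comm]
  ring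

theorem conj_diagPart_apply {H : Matrix (Fin d) (Fin d) ℝ} (hH : H.IsSymm)
    (A : Matrix (Fin d) (Fin d) ℝ) (i j : Fin d) :
    (H * diagPart A * H) i j = ∑ a, H i a * H j a * A a a := by
  rw [Matrix.mul_apply]
  simp only [diagPart, Matrix.mul_diagonal, Matrix.diag_apply]
  exact Finset.sum_congr rfl fun a _ => by rw [hH.apply j a]; ring

theorem sum_sum_mul_eq_mul_mul {P A : Matrix (Fin d) (Fin d) ℝ} (Q : Matrix (Fin d) (Fin d) ℝ)
    (i j : Fin d) : ∑ a, ∑ b, P i a * Q j b * A a b = (P * A * Qᵀ) i j := by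
  rw [Matrix.mul_apply, Finset.sum_comm]
  refine Finset.sum_congr rfl fun b _ => ?_
  rw [Matrix.mul_apply, Finset.sum_mul]
  exact Finset.sum_congr rfl fun a _ => by rw [Matrix.transpose_apply]; ring

theorem sum_sum_dropMoment {p : ℝ} {G : Matrix (Fin d) (Fin d) ℝ} (hG : G.IsSymm)
    (A : Matrix (Fin d) (Fin d) ℝ) (i j : Fin d) :
    ∑ a, ∑ b, G i a * G j b * dropMoment p i j a b * A a b
      = (if i = j then p else p ^ 2) *
        ((pPart p G * A * pPart p G) i j
          + (1 - p) * offDiag G i j * ((pPart p G * A) i i + (A * pPart p G) j j)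
          + ((1 - p) * offDiag G i j) ^ 2 * A j i
          + p * (1 - p) * (offDiag G * diagPart A * offDiag G) i j) := by
  set h := (1 - p) * offDiag G i j with hh
  have hsymm : (1 - p) * offDiag G j i = h := by rw [hh, (isSymm_offDiag hG).apply i j]
  set P := pPart p G with hP
  have hPs : P.IsSymm := isSymm_pPart p hG
  have term (a b : Fin d) : G i a * G j b * dropMoment p i j a b * A a b
      = (if i = j then p else p ^ 2) * (P i a * P j b * A a b
        + h * (P i a * (1 : Matrix (Fin d) (Fin d) ℝ) i b * A a b)
        + h * ((1 : Matrix (Fin d) (Fin d) ℝ) j a * P j b * A a b)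
        + h ^ 2 * ((1 : Matrix (Fin d) (Fin d) ℝ) j a * (1 : Matrix (Fin d) (Fin d) ℝ) i b * A a b)
        + if a = b then p * (1 - p) * (offDiag G i a * offDiag G j a * A a a) else 0) := by
    have e1 := mul_keepProb (p := p) (G := G) i j a
    have e2 := mul_keepProb (p := p) (G := G) j i b
    rw [keepProb_comm, hsymm] at e2
    rw [← hh] at e1
    have e3 : G i a * G j b * (if a = b then keepProb p i j a * (1 - keepProb p i j a) else 0)
        * A a b = if a = b then p * (1 - p) * (offDiag G i a * offDiag G j a * A a a) else 0 := by
      split_ifs with hab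
      · subst hab
        rw [mul_mul_keepProb_var]; ring
      · ring
    rw [← e3, dropMoment]
    linear_combination (if i = j then p else p ^ 2) * A a b *
      (G j b * keepProb p i j b * e1 + (P i a + h * (1 : Matrix (Fin d) (Fin d) ℝ) j a) * e2)
  simp only [term, ← Finset.mul_sum, Finset.sum_add_distrib, sum_sum_mul_eq_mul_mul,
    Finset.sum_ite_eq, Finset.mem_univ, if_true]
  rw [hPs.eq, conj_diagPart_apply (isSymm_offDiag hG)]
  simp only [Matrix.transpose_one, mul_one, one_mul]
  ring

theorem sum_sum_noise {p : ℝ} {G : Matrix (Fin d) (Fin d) ℝ} (hG : G.IsSymm)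
    (B : Matrix (Fin d) (Fin d) ℝ) (i j : Fin d) :
    ∑ a, ∑ b, offDiag G i a * offDiag G j b * ((if i = j then p else p ^ 2) *
        ((p - keepProb p i j a) * (p - keepProb p i j b)
          + if a = b then keepProb p i j a * (1 - keepProb p i j a) else 0)) * B a b
      = (if i = j then p else p ^ 2) *
        (((1 - p) * offDiag G i j) ^ 2 * B j i
          + p * (1 - p) * (offDiag G * diagPart B * offDiag G) i j) := by
  set h := (1 - p) * offDiag G i j with hh
  have hsymm : (1 - p) * offDiag G j i = h := by rw [hh, (isSymm_offDiag hG).apply i j]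
  have term (a b : Fin d) : offDiag G i a * offDiag G j b * ((if i = j then p else p ^ 2) *
        ((p - keepProb p i j a) * (p - keepProb p i j b)
          + if a = b then keepProb p i j a * (1 - keepProb p i j a) else 0)) * B a b
      = (if i = j then p else p ^ 2) * (
        h ^ 2 * ((1 : Matrix (Fin d) (Fin d) ℝ) j a * (1 : Matrix (Fin d) (Fin d) ℝ) i b * B a b)
        + if a = b then p * (1 - p) * (offDiag G i a * offDiag G j a * B a a) else 0) := by
    have e1 := offDiag_mul_sub_keepProb (p := p) (G := G) i j a
    have e2 := offDiag_mul_sub_keepProb (p := p) (G := G) j i b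
    rw [keepProb_comm, hsymm] at e2
    rw [← hh] at e1
    have e3 : offDiag G i a * offDiag G j b *
        (if a = b then keepProb p i j a * (1 - keepProb p i j a) else 0)
        * B a b = if a = b then p * (1 - p) * (offDiag G i a * offDiag G j a * B a a) else 0 := by
      split_ifs with hab
      · subst hab
        rw [offDiag_mul_offDiag_mul_keepProb_var]; ring
      · ring
    rw [← e3]
    linear_combination (if i = j then p else p ^ 2) * B a b *
      (offDiag G j b * (p - keepProb p i j b) * e1
        - h * (1 : Matrix (Fin d) (Fin d) ℝ) j a * e2)
  simp only [term, ← Finset.mul_sum, Finset.sum_add_distrib, sum_sum_mul_eq_mul_mul,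
    Finset.sum_ite_eq, Finset.mem_univ, if_true]
  rw [conj_diagPart_apply (isSymm_offDiag hG)]
  simp only [Matrix.transpose_one, mul_one, one_mul]

namespace IsDropoutMatrix

variable {μ : Measure Ω} [IsProbabilityMeasure μ] {p : unitInterval}
  {D : Ω → Matrix (Fin d) (Fin d) ℝ}

theorem sum_integral_eq_opS (hD : IsDropoutMatrix μ p D) (α : ℝ)
    {G A B : Matrix (Fin d) (Fin d) ℝ} (hG : G.IsSymm) (hA : A.IsSymm) (hB : B.IsSymm)
    (i j : Fin d) :
    ∑ a, ∑ b, (∫ ω, stepMat α G (D ω).diag i a * stepMat α G (D ω).diag j b ∂μ) * A a b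
      + ∑ a, ∑ b, (∫ ω, noiseMat α p G (D ω).diag i a * noiseMat α p G (D ω).diag j b ∂μ) * B a b
      = opS α p G B A i j := by
  have h1 := sum_sum_dropMoment (p := p) hG A i j
  have h2 := sum_sum_noise (p := p) hG B i j
  have hPs : (pPart p G).IsSymm := isSymm_pPart p hG
  have t1 (a b : Fin d) :
      ((1 : Matrix (Fin d) (Fin d) ℝ) i a * (1 : Matrix (Fin d) (Fin d) ℝ) j b
        - (1 : Matrix (Fin d) (Fin d) ℝ) j b * (α * p * pPart p G i a)
        - (1 : Matrix (Fin d) (Fin d) ℝ) i a * (α * p * pPart p G j b)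
        + α ^ 2 * (G i a * G j b * dropMoment p i j a b)) * A a b
      = (1 : Matrix (Fin d) (Fin d) ℝ) i a * (1 : Matrix (Fin d) (Fin d) ℝ) j b * A a b
        - (α * p) * (pPart p G i a * (1 : Matrix (Fin d) (Fin d) ℝ) j b * A a b)
        - (α * p) * ((1 : Matrix (Fin d) (Fin d) ℝ) i a * pPart p G j b * A a b)
        + α ^ 2 * (G i a * G j b * dropMoment p i j a b * A a b) := by ring
  simp only [hD.integral_stepMat_mul_stepMat, hD.integral_noiseMat_mul_noiseMat, t1,
    Finset.sum_add_distrib, Finset.sum_sub_distrib, ← Finset.mul_sum, mul_assoc (α ^ 2)]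
  rw [h1, h2, sum_sum_mul_eq_mul_mul, sum_sum_mul_eq_mul_mul, sum_sum_mul_eq_mul_mul]
  have hPA : (A * pPart p G) j j = (pPart p G * A) j j := by
    rw [← Matrix.transpose_apply (A * pPart p G), Matrix.transpose_mul, hA.eq, hPs.eq]
  have hexp : (1 - (α * p) • pPart p G) * A * (1 - (α * p) • pPart p G)
      = A - (α * p : ℝ) • (pPart p G * A) - (α * p : ℝ) • (A * pPart p G)
        + ((α * p) ^ 2 : ℝ) • (pPart p G * A * pPart p G) := by
    simp only [sub_mul, mul_sub, one_mul, mul_one, Matrix.smul_mul, Matrix.mul_smul, smul_smul,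
      pow_two]
    abel
  rw [opS, hexp]
  simp only [diagPart_add, mul_add, add_mul, Matrix.add_apply, Matrix.sub_apply,
    Matrix.smul_apply, smul_eq_mul, hPs.eq, Matrix.transpose_one, mul_one, one_mul,
    Matrix.hadamard_apply, pPart_add, hPA]
  have m1 (M : Matrix (Fin d) (Fin d) ℝ) : (offDiag G * diagPart M) i j = offDiag G i j * M j j := by
    simp [diagPart, Matrix.mul_diagonal]
  have m2 (M : Matrix (Fin d) (Fin d) ℝ) : (diagPart M * offDiag G) i j = M i i * offDiag G i j := by
    simp [diagPart, Matrix.diagonal_mul]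
  rw [m1, m2, hA.apply i j, hB.apply i j, pPart_apply p (offDiag G * diagPart A * offDiag G),
    pPart_apply p (offDiag G * diagPart B * offDiag G)]
  simp only [diagPart_apply, offDiag_apply G, offDiag_apply (A + B), Matrix.add_apply]
  -- Diagonal entries carry the factor `p`, the others `p ^ 2`. The surplus `p (1 - p)` on the
  -- diagonal is the coefficient of the `diagPart` term of `opS`, and the same ratio produces the
  -- outer `pPart`.
  by_cases hij : i = j
  · subst hij
    simp
    ring
  · simp [hij]
    ring

end IsDropoutMatrix

/-! ### Random matrices acting on independent random vectors -/

/-- A measurable matrix-valued function with almost surely bounded entries along `x`. -/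
structure BoundedAlong (μ : Measure Ω) (x : Ω → Fin d → ℝ)
    (R : (Fin d → ℝ) → Matrix (Fin d) (Fin d) ℝ) : Prop where
  measurable : ∀ i a, Measurable fun v => R v i a
  bounded : ∃ c, ∀ᵐ ω ∂μ, ∀ i a, ‖R (x ω) i a‖ ≤ c

section General

variable {μ : Measure Ω} {x : Ω → Fin d → ℝ}
  {R R' : (Fin d → ℝ) → Matrix (Fin d) (Fin d) ℝ} {U V : Ω → Fin d → ℝ}

theorem SquareIntegrable.add {m : ℕ} {U V : Ω → Fin m → ℝ} (hU : SquareIntegrable μ U)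
    (hV : SquareIntegrable μ V) : SquareIntegrable μ fun ω => U ω + V ω :=
  fun i => (hU i).add (hV i)

theorem SquareIntegrable.sub {m : ℕ} {U V : Ω → Fin m → ℝ} (hU : SquareIntegrable μ U)
    (hV : SquareIntegrable μ V) : SquareIntegrable μ fun ω => U ω - V ω :=
  fun i => (hU i).sub (hV i)

theorem SquareIntegrable.const_mulVec {m l : ℕ} {U : Ω → Fin m → ℝ} (hU : SquareIntegrable μ U)
    (A : Matrix (Fin l) (Fin m) ℝ) : SquareIntegrable μ fun ω => A *ᵥ U ω := fun i => by
  simp only [Matrix.mulVec, dotProduct]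
  exact memLp_finsetSum _ fun a _ => (hU a).const_mul _

theorem SquareIntegrable.integrable_mul {m l : ℕ} {U : Ω → Fin m → ℝ} {V : Ω → Fin l → ℝ}
    (hU : SquareIntegrable μ U) (hV : SquareIntegrable μ V) (i : Fin m) (j : Fin l) :
    Integrable (fun ω => U ω i * V ω j) μ :=
  (hU i).integrable_mul (hV j)

theorem SquareIntegrable.mulVec (hR : BoundedAlong μ x R) (hx : Measurable x)
    (hU : SquareIntegrable μ U) : SquareIntegrable μ fun ω => R (x ω) *ᵥ U ω := fun i => by
  simp only [Matrix.mulVec, dotProduct]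
  refine memLp_finsetSum _ fun a _ => ?_
  obtain ⟨c, hc⟩ := hR.bounded
  refine (hU a).of_le_mul (c := c) ?_ ?_
  · exact (((hR.measurable i a).comp hx).aestronglyMeasurable).mul (hU a).1
  · filter_upwards [hc] with ω h
    rw [norm_mul]
    exact mul_le_mul_of_nonneg_right (h i a) (norm_nonneg _)

theorem integrable_mul_mul (hR : BoundedAlong μ x R) (hR' : BoundedAlong μ x R')
    (hx : Measurable x) (hU : SquareIntegrable μ U) (hV : SquareIntegrable μ V)
    (i j a b : Fin d) :
    Integrable (fun ω => R (x ω) i a * R' (x ω) j b * (U ω a * V ω b)) μ := by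
  obtain ⟨c, hc⟩ := hR.bounded
  obtain ⟨c', hc'⟩ := hR'.bounded
  refine (hU.integrable_mul hV a b).bdd_mul (c := c * c') ?_ ?_
  · exact (((hR.measurable i a).comp hx).mul ((hR'.measurable j b).comp hx)).aestronglyMeasurable
  · filter_upwards [hc, hc'] with ω h h'
    rw [norm_mul]
    exact mul_le_mul (h i a) (h' j b) (norm_nonneg _) ((norm_nonneg _).trans (h i a))

theorem expOuter_mulVec_mulVec [IsProbabilityMeasure μ] (hR : BoundedAlong μ x R)
    (hR' : BoundedAlong μ x R') (hx : Measurable x) (hU : SquareIntegrable μ U)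
    (hV : SquareIntegrable μ V) (hind : IndepFun x (fun ω => (U ω, V ω)) μ) (i j : Fin d) :
    expOuter μ (fun ω => R (x ω) *ᵥ U ω) (fun ω => R' (x ω) *ᵥ V ω) i j
      = ∑ a, ∑ b, (∫ ω, R (x ω) i a * R' (x ω) j b ∂μ) * expOuter μ U V a b := by
  have e (ω : Ω) : (R (x ω) *ᵥ U ω) i * (R' (x ω) *ᵥ V ω) j
      = ∑ a, ∑ b, R (x ω) i a * R' (x ω) j b * (U ω a * V ω b) := by
    simp only [Matrix.mulVec, dotProduct, Finset.sum_mul_sum]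
    exact Finset.sum_congr rfl fun a _ => Finset.sum_congr rfl fun b _ => by ring
  simp only [expOuter, Matrix.of_apply, e]
  rw [integral_finsetSum _ fun a _ => integrable_finsetSum _ fun b _ =>
    integrable_mul_mul hR hR' hx hU hV i j a b]
  refine Finset.sum_congr rfl fun a _ => ?_
  rw [integral_finsetSum _ fun b _ => integrable_mul_mul hR hR' hx hU hV i j a b]
  refine Finset.sum_congr rfl fun b _ => ?_
  have hi := hind.comp ((hR.measurable i a).mul (hR'.measurable j b))
    (((measurable_pi_apply a).comp measurable_fst).mul
      ((measurable_pi_apply b).comp measurable_snd))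
  exact hi.integral_fun_mul_eq_mul_integral
    (((hR.measurable i a).comp hx).mul ((hR'.measurable j b).comp hx)).aestronglyMeasurable
    (hU.integrable_mul hV a b).1

theorem expOuter_add_left {m l : ℕ} {U U' : Ω → Fin m → ℝ} {V : Ω → Fin l → ℝ}
    (hU : SquareIntegrable μ U) (hU' : SquareIntegrable μ U') (hV : SquareIntegrable μ V) :
    expOuter μ (fun ω => U ω + U' ω) V = expOuter μ U V + expOuter μ U' V := by
  ext i j
  simp only [expOuter, Matrix.of_apply, Matrix.add_apply, Pi.add_apply, add_mul]
  exact integral_add (hU.integrable_mul hV i j) (hU'.integrable_mul hV i j)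

theorem expOuter_transpose {m l : ℕ} (U : Ω → Fin m → ℝ) (V : Ω → Fin l → ℝ) :
    (expOuter μ U V)ᵀ = expOuter μ V U := by
  ext i j
  simp only [expOuter, Matrix.of_apply, Matrix.transpose_apply]
  exact integral_congr_ae (ae_of_all _ fun ω => mul_comm _ _)

theorem expOuter_add_right {m l : ℕ} {U : Ω → Fin m → ℝ} {V V' : Ω → Fin l → ℝ}
    (hU : SquareIntegrable μ U) (hV : SquareIntegrable μ V) (hV' : SquareIntegrable μ V') :
    expOuter μ U (fun ω => V ω + V' ω) = expOuter μ U V + expOuter μ U V' := by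
  rw [← expOuter_transpose, expOuter_add_left hV hV' hU, Matrix.transpose_add, expOuter_transpose,
    expOuter_transpose]

theorem isSymm_expOuter {m : ℕ} (U : Ω → Fin m → ℝ) : (expOuter μ U U).IsSymm :=
  expOuter_transpose U U

theorem expOuter_const_mulVec_left {m l k : ℕ} {U : Ω → Fin m → ℝ} {V : Ω → Fin l → ℝ}
    (A : Matrix (Fin k) (Fin m) ℝ) (hU : SquareIntegrable μ U) (hV : SquareIntegrable μ V) :
    expOuter μ (fun ω => A *ᵥ U ω) V = A * expOuter μ U V := by
  ext i j
  simp only [expOuter, Matrix.of_apply, Matrix.mul_apply, Matrix.mulVec, dotProduct,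
    Finset.sum_mul, mul_assoc]
  rw [integral_finsetSum _ fun a _ => (hU.integrable_mul hV a j).const_mul _]
  exact Finset.sum_congr rfl fun a _ => integral_const_mul _ _

/-- Jensen's inequality for the spectral norm, by integrating the bilinear forms. -/
theorem norm_integral_matrix_le [IsProbabilityMeasure μ] {F : Ω → Matrix (Fin d) (Fin d) ℝ} {c : ℝ}
    (hc : 0 ≤ c) (hF : ∀ i j, Integrable (fun ω => F ω i j) μ) (hb : ∀ᵐ ω ∂μ, ‖F ω‖ ≤ c) :
    ‖(Matrix.of fun i j => ∫ ω, F ω i j ∂μ : Matrix (Fin d) (Fin d) ℝ)‖ ≤ c := by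
  refine norm_le_of_two_mul_dotProduct_mulVec_le hc fun u v => ?_
  have hint (i j : Fin d) : Integrable (fun ω => u i * F ω i j * v j) μ :=
    ((hF i j).const_mul _).mul_const _
  have e : u ⬝ᵥ (Matrix.of fun i j => ∫ ω, F ω i j ∂μ : Matrix (Fin d) (Fin d) ℝ) *ᵥ v
      = ∫ ω, u ⬝ᵥ F ω *ᵥ v ∂μ := by
    simp only [dotProduct_mulVec_eq_sum, Matrix.of_apply]
    rw [integral_finsetSum _ fun i _ => integrable_finsetSum _ fun j _ => hint i j]
    refine Finset.sum_congr rfl fun i _ => ?_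
    rw [integral_finsetSum _ fun j _ => hint i j]
    exact Finset.sum_congr rfl fun j _ => by rw [integral_mul_const, integral_const_mul]
  rw [e, ← integral_const_mul]
  have hI : Integrable (fun ω => 2 * (u ⬝ᵥ F ω *ᵥ v)) μ := by
    simp only [dotProduct_mulVec_eq_sum]
    exact (integrable_finsetSum _ fun i _ => integrable_finsetSum _ fun j _ =>
      hint i j).const_mul 2
  have := integral_mono_ae hI (integrable_const (c * (u ⬝ᵥ u + v ⬝ᵥ v))) (by
    filter_upwards [hb] with ω h
    refine (two_mul_dotProduct_mulVec_le (F ω) u v).trans ?_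
    exact mul_le_mul_of_nonneg_right h (add_nonneg
      (Finset.sum_nonneg fun i _ => mul_self_nonneg _)
      (Finset.sum_nonneg fun i _ => mul_self_nonneg _)))
  simpa using this

end General

namespace IsDropoutMatrix

variable {μ : Measure Ω} {p : unitInterval} {D : Ω → Matrix (Fin d) (Fin d) ℝ}

theorem boundedAlong_stepMat (hD : IsDropoutMatrix μ p D) {α : ℝ} (hα : 0 ≤ α)
    (G : Matrix (Fin d) (Fin d) ℝ) : BoundedAlong μ (fun ω => (D ω).diag) (stepMat α G) where
  measurable := measurable_stepMat α G
  bounded := ⟨1 + α * ‖G‖, by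
    filter_upwards [hD.ae_zero_or_one] with ω h i a
    exact (abs_apply_le_norm _ i a).trans (norm_stepMat_le hα G h)⟩

theorem boundedAlong_noiseMat (hD : IsDropoutMatrix μ p D) {α : ℝ} (hα : 0 ≤ α)
    (G : Matrix (Fin d) (Fin d) ℝ) : BoundedAlong μ (fun ω => (D ω).diag) (noiseMat α p G) where
  measurable := measurable_noiseMat α p G
  bounded := ⟨α * ‖offDiag G‖, by
    filter_upwards [hD.ae_zero_or_one] with ω h i a
    exact (abs_apply_le_norm _ i a).trans (norm_noiseMat_le hα p.2.1 p.2.2 G h)⟩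

variable {Z b W : Ω → Fin d → ℝ} {α : ℝ} {G : Matrix (Fin d) (Fin d) ℝ}

/-- One step of the recursion against a random vector from the past. -/
theorem expOuter_step_left [IsProbabilityMeasure μ] (hD : IsDropoutMatrix μ p D) (hα : 0 ≤ α)
    (hZ : SquareIntegrable μ Z) (hb : SquareIntegrable μ b) (hW : SquareIntegrable μ W)
    (hind : IndepFun (fun ω => (D ω).diag) (fun ω => (Z ω, b ω, W ω)) μ) :
    expOuter μ (fun ω => stepMat α G (D ω).diag *ᵥ Z ω + noiseMat α p G (D ω).diag *ᵥ b ω) W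
      = (1 - (α * p) • pPart p G) * expOuter μ Z W := by
  have hM := hD.boundedAlong_stepMat hα G
  have hN := hD.boundedAlong_noiseMat hα G
  have hx := hD.measurable_diag
  have h1 : BoundedAlong μ (fun ω => (D ω).diag) fun _ => (1 : Matrix (Fin d) (Fin d) ℝ) :=
    ⟨fun _ _ => measurable_const, 1, ae_of_all _ fun ω i a => by
      rw [Matrix.one_apply]; split_ifs <;> simp⟩
  rw [expOuter_add_left (hZ.mulVec hM hx) (hb.mulVec hN hx) hW]
  have hW1 : W = fun ω => (1 : Matrix (Fin d) (Fin d) ℝ) *ᵥ W ω := by simp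
  have eZ := expOuter_mulVec_mulVec hM h1 hx hZ hW (hind.comp measurable_id
    (measurable_fst.prodMk (measurable_snd.comp measurable_snd)))
  have eb := expOuter_mulVec_mulVec hN h1 hx hb hW (hind.comp measurable_id measurable_snd)
  rw [← hW1] at eZ eb
  ext i j
  rw [Matrix.add_apply, eZ, eb, Matrix.mul_apply]
  simp only [integral_mul_const, hD.integral_stepMat, hD.integral_noiseMat, zero_mul,
    Finset.sum_const_zero, add_zero]
  exact Finset.sum_congr rfl fun a _ => by simp [Matrix.one_apply]

/-- One step of the recursion for the second moment. -/
theorem norm_expOuter_step_sub_opS_le [IsProbabilityMeasure μ] (hD : IsDropoutMatrix μ p D)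
    (hα : 0 ≤ α) (hG : G.IsSymm) (hZ : SquareIntegrable μ Z) (hb : SquareIntegrable μ b)
    (hind : IndepFun (fun ω => (D ω).diag) (fun ω => (Z ω, b ω)) μ) :
    ‖expOuter μ (fun ω => stepMat α G (D ω).diag *ᵥ Z ω + noiseMat α p G (D ω).diag *ᵥ b ω)
        (fun ω => stepMat α G (D ω).diag *ᵥ Z ω + noiseMat α p G (D ω).diag *ᵥ b ω)
      - opS α p G (expOuter μ b b) (expOuter μ Z Z)‖
      ≤ 2 * ((1 + α * ‖G‖) * ‖expOuter μ Z b‖ * (α * ‖offDiag G‖)) := by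
  have hM := hD.boundedAlong_stepMat hα G
  have hN := hD.boundedAlong_noiseMat hα G
  have hx := hD.measurable_diag
  have sM := hZ.mulVec hM hx
  have sN := hb.mulVec hN hx
  set C := expOuter μ (fun ω => stepMat α G (D ω).diag *ᵥ Z ω)
    (fun ω => noiseMat α p G (D ω).diag *ᵥ b ω) with hC
  have hfst : IndepFun (fun ω => (D ω).diag) (fun ω => (Z ω, Z ω)) μ :=
    hind.comp measurable_id (measurable_fst.prodMk measurable_fst)
  have hsnd : IndepFun (fun ω => (D ω).diag) (fun ω => (b ω, b ω)) μ :=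
    hind.comp measurable_id (measurable_snd.prodMk measurable_snd)
  have hsum : expOuter μ (fun ω => stepMat α G (D ω).diag *ᵥ Z ω)
        (fun ω => stepMat α G (D ω).diag *ᵥ Z ω)
      + expOuter μ (fun ω => noiseMat α p G (D ω).diag *ᵥ b ω)
        (fun ω => noiseMat α p G (D ω).diag *ᵥ b ω)
      = opS α p G (expOuter μ b b) (expOuter μ Z Z) := by
    ext i j
    rw [Matrix.add_apply, expOuter_mulVec_mulVec hM hM hx hZ hZ hfst,
      expOuter_mulVec_mulVec hN hN hx hb hb hsnd]
    exact hD.sum_integral_eq_opS α hG (isSymm_expOuter Z) (isSymm_expOuter b) i j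
  -- By independence, the cross term is the mean of `M E[Z bᵀ] Nᵀ`, and `M` and `N` are almost
  -- surely bounded in norm.
  have hCn : ‖C‖ ≤ (1 + α * ‖G‖) * ‖expOuter μ Z b‖ * (α * ‖offDiag G‖) := by
    have hint (i j a c : Fin d) : Integrable (fun ω =>
        stepMat α G (D ω).diag i a * noiseMat α p G (D ω).diag j c * expOuter μ Z b a c) μ := by
      obtain ⟨c₁, hc₁⟩ := hM.bounded
      obtain ⟨c₂, hc₂⟩ := hN.bounded
      refine Integrable.mul_const (Integrable.of_bound ?_ (c₁ * c₂) ?_) _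
      · exact (((hM.measurable i a).comp hx).mul
          ((hN.measurable j c).comp hx)).aestronglyMeasurable
      · filter_upwards [hc₁, hc₂] with ω h h'
        rw [norm_mul]
        exact mul_le_mul (h i a) (h' j c) (norm_nonneg _) ((norm_nonneg _).trans (h i a))
    have hent (i j : Fin d) (ω : Ω) :
        (stepMat α G (D ω).diag * expOuter μ Z b * (noiseMat α p G (D ω).diag)ᵀ) i j
          = ∑ a, ∑ c,
            stepMat α G (D ω).diag i a * noiseMat α p G (D ω).diag j c * expOuter μ Z b a c :=
      (sum_sum_mul_eq_mul_mul _ i j).symm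
    have hF (i j : Fin d) : Integrable (fun ω =>
        (stepMat α G (D ω).diag * expOuter μ Z b * (noiseMat α p G (D ω).diag)ᵀ) i j) μ := by
      simp only [hent]
      exact integrable_finsetSum _ fun a _ => integrable_finsetSum _ fun c _ => hint i j a c
    have hCe : C = Matrix.of fun i j => ∫ ω,
        (stepMat α G (D ω).diag * expOuter μ Z b * (noiseMat α p G (D ω).diag)ᵀ) i j ∂μ := by
      ext i j
      rw [hC, expOuter_mulVec_mulVec hM hN hx hZ hb hind, Matrix.of_apply]
      simp only [hent]
      rw [integral_finsetSum _ fun a _ => integrable_finsetSum _ fun c _ => hint i j a c]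
      refine Finset.sum_congr rfl fun a _ => ?_
      rw [integral_finsetSum _ fun c _ => hint i j a c]
      exact Finset.sum_congr rfl fun c _ => (integral_mul_const _ _).symm
    rw [hCe]
    refine norm_integral_matrix_le (by positivity) hF ?_
    filter_upwards [hD.ae_zero_or_one] with ω h
    refine norm_mul_le_of_le (norm_mul_le_of_le (norm_stepMat_le hα G h) le_rfl) ?_
    rw [norm_transpose]
    exact norm_noiseMat_le hα p.2.1 p.2.2 G h
  rw [expOuter_add_left sM sN (sM.add sN), expOuter_add_right sM sM sN,
    expOuter_add_right sN sM sN, ← hsum, ← expOuter_transpose (fun ω => stepMat α G _ *ᵥ Z ω)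
      (fun ω => noiseMat α p G _ *ᵥ b ω), ← hC]
  have : ∀ P Q : Matrix (Fin d) (Fin d) ℝ, P + C + (Cᵀ + Q) - (P + Q) = C + Cᵀ := by
    intro P Q; abel
  rw [this]
  refine (norm_add_le _ _).trans ?_
  rw [norm_transpose]
  linarith

end IsDropoutMatrix

/-! ### Independence of the past and the next dropout matrix -/

/-- Regrouping of three mutually independent variables, checked on measurable rectangles. -/
theorem indepFun_prodMk_of_indepFun {α β γ : Type*} [MeasurableSpace α] [MeasurableSpace β]
    [MeasurableSpace γ] {μ : Measure Ω} [IsProbabilityMeasure μ] {f : Ω → α} {g : Ω → β}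
    {h : Ω → γ} (hf : Measurable f) (hg : Measurable g) (hh : Measurable h)
    (hfg : IndepFun f g μ) (hfgh : IndepFun (fun ω => (f ω, g ω)) h μ) :
    IndepFun (fun ω => (h ω, f ω)) g μ := by
  have hfh : IndepFun f h μ := hfgh.comp measurable_fst measurable_id
  have : IsProbabilityMeasure (μ.map fun ω => ((h ω, f ω), g ω)) :=
    Measure.isProbabilityMeasure_map ((hh.prodMk hf).prodMk hg).aemeasurable
  rw [indepFun_iff_map_prod_eq_prod_map_map (hh.prodMk hf).aemeasurable hg.aemeasurable,
    Measure.ext_prod₃_iff']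
  intro s t u hs ht hu
  rw [Measure.map_apply ((hh.prodMk hf).prodMk hg) ((hs.prod ht).prod hu), Measure.prod_prod,
    Measure.map_apply (hh.prodMk hf) (hs.prod ht), Measure.map_apply hg hu]
  have e1 : (fun ω => ((h ω, f ω), g ω)) ⁻¹' ((s ×ˢ t) ×ˢ u)
      = (fun ω => (f ω, g ω)) ⁻¹' (t ×ˢ u) ∩ h ⁻¹' s := by ext; simp; tauto
  have e2 : (fun ω => (h ω, f ω)) ⁻¹' (s ×ˢ t) = f ⁻¹' t ∩ h ⁻¹' s := by ext; simp; tauto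
  have e3 : (fun ω => (f ω, g ω)) ⁻¹' (t ×ˢ u) = f ⁻¹' t ∩ g ⁻¹' u := by ext; simp
  rw [e1, e2, hfgh.measure_inter_preimage_eq_mul _ _ (ht.prod hu) hs, e3,
    hfg.measure_inter_preimage_eq_mul _ _ ht hu, hfh.measure_inter_preimage_eq_mul _ _ ht hs]
  ring

/-! ### Elementary sums -/

theorem sum_range_le_of_le_mul_add {a : ℕ → ℝ} {q r : ℝ} (ha : ∀ k, 0 ≤ a k) (hq0 : 0 ≤ q)
    (hq : q < 1) (hr : 0 ≤ r) (h : ∀ k, a (k + 1) ≤ q * a k + r * q ^ k) (k : ℕ) :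
    ∑ l ∈ Finset.range k, a l ≤ a 0 / (1 - q) + r / (1 - q) ^ 2 := by
  have hs : 0 < 1 - q := sub_pos.2 hq
  -- The two added terms form a potential that drops by at least `a k` at each step.
  have key : ∑ l ∈ Finset.range k, a l + a k / (1 - q) + r * q ^ k / (1 - q) ^ 2
      ≤ a 0 / (1 - q) + r / (1 - q) ^ 2 := by
    induction k with
    | zero => simp
    | succ k ih =>
      refine le_trans ?_ ih
      have h1 : a (k + 1) / (1 - q) ≤ (q * a k + r * q ^ k) / (1 - q) := by
        gcongr; exact h k
      have e : a k + (q * a k + r * q ^ k) / (1 - q) + r * q ^ (k + 1) / (1 - q) ^ 2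
          = a k / (1 - q) + r * q ^ k / (1 - q) ^ 2 := by
        field_simp; ring
      rw [Finset.sum_range_succ]
      linarith
  have h1 : 0 ≤ a k / (1 - q) := div_nonneg (ha k) hs.le
  have h2 : 0 ≤ r * q ^ k / (1 - q) ^ 2 := by positivity
  linarith

theorem sum_ite_pow_sub_le {q : ℝ} (hq0 : 0 ≤ q) (hq : q < 1) (k m : ℕ) :
    ∑ l ∈ Finset.Icc 1 k, (if m ≤ l then q ^ (l - m) else 0) ≤ 1 / (1 - q) := by
  have hs : 0 < 1 - q := sub_pos.2 hq
  -- Truncated subtraction makes the right-hand side 0 for `k ≤ m`, where the sum is empty of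
  -- nonzero terms.
  have key (k : ℕ) : ∑ l ∈ Finset.range k, (if m ≤ l then q ^ (l - m) else 0)
      ≤ (1 - q ^ (k - m)) / (1 - q) := by
    induction k with
    | zero => simp
    | succ k ih =>
      rw [Finset.sum_range_succ]
      split_ifs with hm
      · rw [Nat.succ_sub hm, pow_succ]
        refine (add_le_add_left ih _).trans_eq ?_
        field_simp
        ring
      · have h1 : k - m = 0 := by omega
        have h2 : k + 1 - m = 0 := by omega
        rw [h1] at ih
        rw [h2]
        simpa using ih
  calc _ ≤ ∑ l ∈ Finset.range (k + 1), (if m ≤ l then q ^ (l - m) else 0) := by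
        refine Finset.sum_le_sum_of_subset_of_nonneg (fun l hl => ?_) fun l _ _ => ?_
        · rw [Finset.mem_Icc] at hl
          exact Finset.mem_range.2 (by omega)
        · split_ifs <;> positivity
    _ ≤ _ := key (k + 1)
    _ ≤ _ := by
      gcongr
      linarith [pow_nonneg hq0 (k + 1 - m)]

theorem sum_sum_le_of_geometric {f : ℕ → ℕ → ℝ} {a : ℕ → ℝ} {q : ℝ} (hq0 : 0 ≤ q) (hq : q < 1)
    (ha : ∀ l, 0 ≤ a l) (hf : ∀ l m, m ≤ l → f l m ≤ q ^ (l - m) * a m)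
    (hsymm : ∀ l m, f l m = f m l) (k : ℕ) :
    ∑ l ∈ Finset.Icc 1 k, ∑ m ∈ Finset.Icc 1 k, f l m
      ≤ 2 / (1 - q) * ∑ m ∈ Finset.Icc 1 k, a m := by
  -- Both orderings are added, which counts the diagonal twice; this is harmless because `a` is
  -- nonnegative.
  have h1 (l m : ℕ) : f l m ≤ (if m ≤ l then q ^ (l - m) else 0) * a m
      + (if l ≤ m then q ^ (m - l) else 0) * a l := by
    have hp (l m : ℕ) : 0 ≤ (if m ≤ l then q ^ (l - m) else 0) * a m := by
      have := ha m
      split_ifs <;> positivity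
    rcases le_total m l with h | h
    · have := hp m l
      have := hf l m h
      rw [if_pos h]
      linarith
    · have := hp l m
      have := hf m l h
      rw [hsymm l m, if_pos h]
      linarith
  have h2 : ∑ m ∈ Finset.Icc 1 k, ∑ l ∈ Finset.Icc 1 k, (if m ≤ l then q ^ (l - m) else 0) * a m
      ≤ 1 / (1 - q) * ∑ m ∈ Finset.Icc 1 k, a m := by
    rw [Finset.mul_sum]
    refine Finset.sum_le_sum fun m _ => ?_
    rw [← Finset.sum_mul]
    exact mul_le_mul_of_nonneg_right (sum_ite_pow_sub_le hq0 hq k m) (ha m)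
  calc _ ≤ ∑ l ∈ Finset.Icc 1 k, ∑ m ∈ Finset.Icc 1 k,
        ((if m ≤ l then q ^ (l - m) else 0) * a m + (if l ≤ m then q ^ (m - l) else 0) * a l) :=
        Finset.sum_le_sum fun l _ => Finset.sum_le_sum fun m _ => h1 l m
    _ = ∑ m ∈ Finset.Icc 1 k, ∑ l ∈ Finset.Icc 1 k, (if m ≤ l then q ^ (l - m) else 0) * a m
        + ∑ m ∈ Finset.Icc 1 k, ∑ l ∈ Finset.Icc 1 k, (if m ≤ l then q ^ (l - m) else 0) * a m := by
        simp only [Finset.sum_add_distrib]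
        congr 1
        exact Finset.sum_comm
    _ ≤ 1 / (1 - q) * ∑ m ∈ Finset.Icc 1 k, a m + 1 / (1 - q) * ∑ m ∈ Finset.Icc 1 k, a m :=
        add_le_add h2 h2
    _ = _ := by ring

/-! ### The error process -/

/-- A square integrable process driven by dropout matrices that are independent of its past. -/
structure IsErrorProcess (μ : Measure Ω) (α : ℝ) (p : unitInterval)
    (G : Matrix (Fin d) (Fin d) ℝ) (D : ℕ → Ω → Matrix (Fin d) (Fin d) ℝ) (b : Ω → Fin d → ℝ)
    (Z : ℕ → Ω → Fin d → ℝ) : Prop where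
  dropout : ∀ k, IsDropoutMatrix μ p (D k)
  symm : G.IsSymm
  sq_b : SquareIntegrable μ b
  sq_zero : SquareIntegrable μ (Z 0)
  step : ∀ k, Z (k + 1) =ᵐ[μ]
    fun ω => stepMat α G (D k ω).diag *ᵥ Z k ω + noiseMat α p G (D k ω).diag *ᵥ b ω
  indep : ∀ k l, l ≤ k → IndepFun (fun ω => (D k ω).diag) (fun ω => (Z k ω, b ω, Z l ω)) μ

theorem expOuter_congr {m l : ℕ} {μ : Measure Ω} {U U' : Ω → Fin m → ℝ} {V V' : Ω → Fin l → ℝ}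
    (hU : U =ᵐ[μ] U') (hV : V =ᵐ[μ] V') : expOuter μ U V = expOuter μ U' V' := by
  ext i j
  simp only [expOuter, Matrix.of_apply]
  refine integral_congr_ae ?_
  filter_upwards [hU, hV] with ω h h'
  rw [h, h']

theorem expOuter_smul_sum {ι : Type*} {m : ℕ} {μ : Measure Ω} {Z : ι → Ω → Fin m → ℝ}
    (hZ : ∀ l, SquareIntegrable μ (Z l)) (c : ℝ) (s : Finset ι) :
    expOuter μ (fun ω => c • ∑ l ∈ s, Z l ω) (fun ω => c • ∑ l ∈ s, Z l ω)
      = c ^ 2 • ∑ l ∈ s, ∑ l' ∈ s, expOuter μ (Z l) (Z l') := by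
  ext i j
  simp only [expOuter, Matrix.of_apply, Matrix.smul_apply, Matrix.sum_apply, Pi.smul_apply,
    Finset.sum_apply, smul_eq_mul]
  have e (ω : Ω) : (c * ∑ l ∈ s, Z l ω i) * (c * ∑ l ∈ s, Z l ω j)
      = c ^ 2 * ∑ l ∈ s, ∑ l' ∈ s, Z l ω i * Z l' ω j := by
    rw [← Finset.sum_mul_sum]; ring
  simp only [e]
  rw [integral_const_mul, integral_finsetSum _ fun l _ => integrable_finsetSum _ fun l' _ =>
    (hZ l).integrable_mul (hZ l') i j]
  congr 1
  refine Finset.sum_congr rfl fun l _ => ?_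
  rw [integral_finsetSum _ fun l' _ => (hZ l).integrable_mul (hZ l') i j]

namespace IsErrorProcess

variable {μ : Measure Ω} {α : ℝ} {p : unitInterval}
  {G : Matrix (Fin d) (Fin d) ℝ} {D : ℕ → Ω → Matrix (Fin d) (Fin d) ℝ} {b : Ω → Fin d → ℝ}
  {Z : ℕ → Ω → Fin d → ℝ}

theorem sq (h : IsErrorProcess μ α p G D b Z) (hα : 0 ≤ α) (k : ℕ) :
    SquareIntegrable μ (Z k) := by
  induction k with
  | zero => exact h.sq_zero
  | succ k ih =>
    have hs := (ih.mulVec ((h.dropout k).boundedAlong_stepMat hα G)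
      (h.dropout k).measurable_diag).add (h.sq_b.mulVec
        ((h.dropout k).boundedAlong_noiseMat hα G) (h.dropout k).measurable_diag)
    intro i
    refine (memLp_congr_ae ?_).2 (hs i)
    filter_upwards [h.step k] with ω hω
    rw [hω]

variable [IsProbabilityMeasure μ]

theorem expOuter_succ (h : IsErrorProcess μ α p G D b Z) (hα : 0 ≤ α) {k l : ℕ} (hl : l ≤ k) :
    expOuter μ (Z (k + 1)) (Z l) = (1 - (α * p) • pPart p G) * expOuter μ (Z k) (Z l) := by
  rw [expOuter_congr (h.step k) (EventuallyEq.refl _ (Z l))]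
  exact (h.dropout k).expOuter_step_left hα (h.sq hα k) h.sq_b (h.sq hα l) (h.indep k l hl)

theorem norm_expOuter_le (h : IsErrorProcess μ α p G D b Z) (hα : 0 ≤ α) {q : ℝ}
    (hq : ‖1 - (α * p) • pPart p G‖ ≤ q) {l m : ℕ} (hm : m ≤ l) :
    ‖expOuter μ (Z l) (Z m)‖ ≤ q ^ (l - m) * ‖expOuter μ (Z m) (Z m)‖ := by
  induction l, hm using Nat.le_induction with
  | base => simp
  | succ l hm ih =>
    rw [h.expOuter_succ hα hm, Nat.succ_sub hm, pow_succ']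
    exact (norm_mul_le_of_le hq ih).trans_eq (by ring)

theorem norm_expOuter_b_le (h : IsErrorProcess μ α p G D b Z) (hα : 0 ≤ α) {q : ℝ}
    (hq : ‖1 - (α * p) • pPart p G‖ ≤ q) (k : ℕ) :
    ‖expOuter μ (Z k) b‖ ≤ q ^ k * ‖expOuter μ (Z 0) b‖ := by
  induction k with
  | zero => simp
  | succ k ih =>
    have hind : IndepFun (fun ω => (D k ω).diag) (fun ω => (Z k ω, b ω, b ω)) μ :=
      (h.indep k k le_rfl).comp measurable_id (measurable_fst.prodMk
        ((measurable_fst.comp measurable_snd).prodMk (measurable_fst.comp measurable_snd)))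
    rw [expOuter_congr (h.step k) (EventuallyEq.refl _ b),
      (h.dropout k).expOuter_step_left hα (h.sq hα k) h.sq_b h.sq_b hind, pow_succ']
    exact (norm_mul_le_of_le hq ih).trans_eq (by ring)

theorem norm_expOuter_succ_sub_opS_le (h : IsErrorProcess μ α p G D b Z) (hα : 0 ≤ α) (k : ℕ) :
    ‖expOuter μ (Z (k + 1)) (Z (k + 1)) - opS α p G (expOuter μ b b) (expOuter μ (Z k) (Z k))‖
      ≤ 2 * ((1 + α * ‖G‖) * ‖expOuter μ (Z k) b‖ * (α * ‖offDiag G‖)) := by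
  rw [expOuter_congr (h.step k) (h.step k)]
  refine (h.dropout k).norm_expOuter_step_sub_opS_le hα h.symm (h.sq hα k) h.sq_b ?_
  exact (h.indep k k le_rfl).comp measurable_id
    (measurable_fst.prodMk (measurable_fst.comp measurable_snd))

/-- Distance of the second moments from the fixed point of `S`. -/
theorem sum_norm_expOuter_sub_limitMatrix_le (h : IsErrorProcess μ α p G D b Z) (hα : 0 ≤ α)
    {q : ℝ} (hq1 : q < 1) (hq : ‖1 - (α * p) • pPart p G‖ ≤ q)
    (hS : ∀ A, ‖opSLin α p G (expOuter μ b b) A‖ ≤ q * ‖A‖)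
    (hG1 : α * ‖G‖ ≤ 1) (hG2 : α * ‖offDiag G‖ ≤ 1) (k : ℕ) :
    ∑ l ∈ Finset.Icc 1 k,
        ‖expOuter μ (Z l) (Z l) - limitMatrix α p G (expOuter μ b b)‖
      ≤ ‖expOuter μ (Z 0) (Z 0) - limitMatrix α p G (expOuter μ b b)‖ / (1 - q)
        + 6 * ‖expOuter μ (Z 0) b‖ / (1 - q) ^ 2 := by
  have hq0 : 0 ≤ q := (norm_nonneg _).trans hq
  set B := expOuter μ b b
  set L := limitMatrix α p G B with hL
  have hLe : L = opSLin α p G B L + opS α p G B 0 := limitMatrix_eq hq1 hS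
  -- The term `l = 0` is added to the sum, so that the recursion starts at the initialization.
  refine le_trans ?_ (sum_range_le_of_le_mul_add
    (a := fun l => ‖expOuter μ (Z l) (Z l) - L‖) (fun _ => norm_nonneg _) hq0 hq1
    (by positivity) (fun l => ?_) (k + 1))
  · refine Finset.sum_le_sum_of_subset_of_nonneg (fun l hl => ?_) fun l _ _ => norm_nonneg _
    rw [Finset.mem_Icc] at hl
    exact Finset.mem_range.2 (by omega)
  · have e : expOuter μ (Z (l + 1)) (Z (l + 1)) - L
        = opSLin α p G B (expOuter μ (Z l) (Z l) - L)
          + (expOuter μ (Z (l + 1)) (Z (l + 1)) - opS α p G B (expOuter μ (Z l) (Z l))) := by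
      have e1 : opSLin α p G B (expOuter μ (Z l) (Z l))
          = opS α p G B (expOuter μ (Z l) (Z l)) - opS α p G B 0 := rfl
      rw [map_sub, e1]
      nth_rw 1 [hLe]
      abel
    rw [e]
    refine norm_add_le_of_le (hS _) ((h.norm_expOuter_succ_sub_opS_le hα l).trans ?_)
    have h1 := h.norm_expOuter_b_le hα hq l
    have h0 : 0 ≤ α * ‖offDiag G‖ := by positivity
    -- The step-size bounds give the constant 4, which is relaxed to 6.
    calc 2 * ((1 + α * ‖G‖) * ‖expOuter μ (Z l) b‖ * (α * ‖offDiag G‖))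
        ≤ 2 * ((1 + 1) * (q ^ l * ‖expOuter μ (Z 0) b‖) * 1) := by gcongr
      _ ≤ 6 * ‖expOuter μ (Z 0) b‖ * q ^ l := by
        have : 0 ≤ q ^ l * ‖expOuter μ (Z 0) b‖ := by positivity
        linarith

/-- The averaged error. -/
theorem norm_expOuter_average_le (h : IsErrorProcess μ α p G D b Z) (hα : 0 ≤ α)
    {q : ℝ} (hq1 : q < 1) (hq : ‖1 - (α * p) • pPart p G‖ ≤ q)
    (hS : ∀ A, ‖opSLin α p G (expOuter μ b b) A‖ ≤ q * ‖A‖)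
    (hG1 : α * ‖G‖ ≤ 1) (hG2 : α * ‖offDiag G‖ ≤ 1) {k : ℕ} (hk : 1 ≤ k) :
    ‖expOuter μ (fun ω => (k : ℝ)⁻¹ • ∑ l ∈ Finset.Icc 1 k, Z l ω)
        (fun ω => (k : ℝ)⁻¹ • ∑ l ∈ Finset.Icc 1 k, Z l ω)‖
      ≤ 2 * ‖opS α p G (expOuter μ b b) 0‖ / (k * (1 - q) ^ 2)
        + 2 * (‖expOuter μ (Z 0) (Z 0) - limitMatrix α p G (expOuter μ b b)‖ / (1 - q) ^ 2
          + 6 * ‖expOuter μ (Z 0) b‖ / (1 - q) ^ 3) / k ^ 2 := by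
  have hq0 : 0 ≤ q := (norm_nonneg _).trans hq
  have hs : 0 < 1 - q := sub_pos.2 hq1
  have hk0 : (0 : ℝ) < k := by exact_mod_cast hk
  set B := expOuter μ b b
  set L := limitMatrix α p G B with hL
  have hLn : ‖L‖ ≤ ‖opS α p G B 0‖ / (1 - q) := norm_limitMatrix_le hq1 hS
  have h1 := h.sum_norm_expOuter_sub_limitMatrix_le hα hq1 hq hS hG1 hG2 k
  -- A transient part bounded uniformly in `k`, plus `k` copies of the bound for the fixed point.
  have h2 : ∑ l ∈ Finset.Icc 1 k, ‖expOuter μ (Z l) (Z l)‖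
      ≤ (‖expOuter μ (Z 0) (Z 0) - L‖ / (1 - q) + 6 * ‖expOuter μ (Z 0) b‖ / (1 - q) ^ 2)
        + k * (‖opS α p G B 0‖ / (1 - q)) := by
    calc _ ≤ ∑ l ∈ Finset.Icc 1 k, (‖expOuter μ (Z l) (Z l) - L‖ + ‖opS α p G B 0‖ / (1 - q)) := by
          refine Finset.sum_le_sum fun l _ => ?_
          have := norm_add_le (expOuter μ (Z l) (Z l) - L) L
          rw [sub_add_cancel] at this
          linarith
      _ ≤ _ := by
          rw [Finset.sum_add_distrib, Finset.sum_const, Nat.card_Icc, nsmul_eq_mul,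
            Nat.add_sub_cancel]
          linarith
  have h3 := sum_sum_le_of_geometric (f := fun l m => ‖expOuter μ (Z l) (Z m)‖)
    (a := fun m => ‖expOuter μ (Z m) (Z m)‖) hq0 hq1 (fun _ => norm_nonneg _)
    (fun l m hm => h.norm_expOuter_le hα hq hm)
    (fun l m => by rw [← expOuter_transpose, norm_transpose]) k
  rw [expOuter_smul_sum (h.sq hα), norm_smul, Real.norm_of_nonneg (by positivity)]
  have h4 : ‖∑ l ∈ Finset.Icc 1 k, ∑ m ∈ Finset.Icc 1 k, expOuter μ (Z l) (Z m)‖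
      ≤ ∑ l ∈ Finset.Icc 1 k, ∑ m ∈ Finset.Icc 1 k, ‖expOuter μ (Z l) (Z m)‖ :=
    (norm_sum_le _ _).trans (Finset.sum_le_sum fun l _ => norm_sum_le _ _)
  have h5 := mul_le_mul_of_nonneg_left h2 (show 0 ≤ 2 / (1 - q) by positivity)
  refine (mul_le_mul_of_nonneg_left (h4.trans (h3.trans h5)) (by positivity)).trans_eq ?_
  field_simp
  ring

end IsErrorProcess

/-! ### Gradient descent with dropout as an error process -/

/-- On the diagonal, `x i * (G i i - G i i * x i)` vanishes because `x i` is 0 or 1; off the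
diagonal both sides are `x i * G i a * (p - x a)`. -/
theorem diagonal_mul_pPart_sub {x : Fin d → ℝ} (hx : ∀ i, x i = 0 ∨ x i = 1) (p : ℝ)
    (G : Matrix (Fin d) (Fin d) ℝ) :
    Matrix.diagonal x * (pPart p G - G * Matrix.diagonal x)
      = Matrix.diagonal x * offDiag G * (p • (1 : Matrix (Fin d) (Fin d) ℝ) - Matrix.diagonal x) := by
  rw [Matrix.smul_one_eq_diagonal, Matrix.diagonal_sub]
  ext i a
  simp only [Matrix.diagonal_mul, Matrix.mul_diagonal, Matrix.sub_apply, pPart_apply, offDiag_apply]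
  rcases eq_or_ne i a with rfl | h
  · rcases hx i with h | h <;> simp [h]
  · simp only [if_neg h]; ring

theorem step_sub_eq {x : Fin d → ℝ} (hx : ∀ i, x i = 0 ∨ x i = 1) (α p : ℝ)
    (X : Matrix (Fin n) (Fin d) ℝ) (y : Fin n → ℝ) (β b : Fin d → ℝ)
    (hb : pPart p (gram X) *ᵥ b = Xᵀ *ᵥ y) :
    β + α • (Matrix.diagonal x *ᵥ (Xᵀ *ᵥ (y - X *ᵥ (Matrix.diagonal x *ᵥ β)))) - b
      = stepMat α (gram X) x *ᵥ (β - b) + noiseMat α p (gram X) x *ᵥ b := by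
  rw [noiseMat, ← diagonal_mul_pPart_sub hx, stepMat]
  simp only [Matrix.mulVec_sub, Matrix.sub_mulVec, Matrix.smul_mulVec, Matrix.one_mulVec,
    mul_sub, smul_sub, ← hb, Matrix.mulVec_mulVec, gram, Matrix.mul_assoc]
  abel

/-- Initial data and the dropout vectors used before step `k`. -/
def history (D : ℕ → Ω → Matrix (Fin d) (Fin d) ℝ) (Y : Ω → Fin n → ℝ) (β₀ : Ω → Fin d → ℝ)
    (k : ℕ) (ω : Ω) : ((Fin n → ℝ) × (Fin d → ℝ)) × (Finset.range k → Fin d → ℝ) :=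
  ((Y ω, β₀ ω), fun j => (D j ω).diag)

theorem measurable_step (α : ℝ) (X : Matrix (Fin n) (Fin d) ℝ) :
    Measurable fun z : (Fin d → ℝ) × (Fin d → ℝ) × (Fin n → ℝ) =>
      z.1 + α • (Matrix.diagonal z.2.1 *ᵥ
        (Xᵀ *ᵥ (z.2.2 - X *ᵥ (Matrix.diagonal z.2.1 *ᵥ z.1)))) := by
  refine Continuous.measurable ?_
  have h1 : Continuous fun z : (Fin d → ℝ) × (Fin d → ℝ) × (Fin n → ℝ) =>
      Matrix.diagonal z.2.1 := (continuous_fst.comp continuous_snd).matrix_diagonal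
  refine continuous_fst.add (Continuous.const_smul (h1.matrix_mulVec ?_) α)
  refine Continuous.matrix_mulVec continuous_const ?_
  refine (continuous_snd.comp continuous_snd).sub ?_
  exact Continuous.matrix_mulVec continuous_const (h1.matrix_mulVec continuous_fst)

/-- All iterates up to `k` are functions of one common history, so any tuple of them is jointly
independent of the next dropout matrix. -/
theorem exists_iterate_eq_comp_history {Ω : Type*} {D : ℕ → Ω → Matrix (Fin d) (Fin d) ℝ}
    (hD : ∀ k ω, (D k ω).IsDiag) (α : ℝ) (X : Matrix (Fin n) (Fin d) ℝ) (Y : Ω → Fin n → ℝ)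
    (β₀ : Ω → Fin d → ℝ) {k l : ℕ} (hl : l ≤ k) :
    ∃ φ : ((Fin n → ℝ) × (Fin d → ℝ)) × (Finset.range k → Fin d → ℝ) → Fin d → ℝ,
      Measurable φ ∧ ∀ ω, iterate α X D Y β₀ l ω = φ (history D Y β₀ k ω) := by
  induction l with
  | zero => exact ⟨fun h => h.1.2, measurable_snd.comp measurable_fst, fun ω => rfl⟩
  | succ l ih =>
    obtain ⟨φ, hφ, h⟩ := ih (by omega)
    have hl' : l ∈ Finset.range k := Finset.mem_range.2 hl
    refine ⟨_, (measurable_step α X).comp (hφ.prodMk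
      (((measurable_pi_apply (⟨l, hl'⟩ : Finset.range k)).comp measurable_snd).prodMk
        (measurable_fst.comp measurable_fst))), fun ω => ?_⟩
    simp only [iterate, Function.comp_apply, history, (hD l ω).diagonal_diag]
    rw [h ω]
    rfl

theorem indepFun_diag_history {μ : Measure Ω} [IsProbabilityMeasure μ]
    {D : ℕ → Ω → Matrix (Fin d) (Fin d) ℝ} {Y : Ω → Fin n → ℝ} {β₀ : Ω → Fin d → ℝ}
    (hD : ∀ k, Measurable fun ω => (D k ω).diag) (hY : Measurable Y) (hβ₀ : Measurable β₀)
    (hD_indep : iIndepFun (fun k ω => (D k ω).diag) μ)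
    (hD_data : IndepFun (fun ω k => (D k ω).diag) (fun ω => (Y ω, β₀ ω)) μ) (k : ℕ) :
    IndepFun (fun ω => (D k ω).diag) (history D Y β₀ k) μ := by
  have hpast : Measurable fun ω (j : Finset.range k) => (D j ω).diag :=
    measurable_pi_lambda _ fun j => hD j
  have h1 : IndepFun (fun ω (j : Finset.range k) => (D j ω).diag) (fun ω => (D k ω).diag) μ :=
    (hD_indep.indepFun_finset (Finset.range k) {k} (by simp) hD).comp measurable_id
      (measurable_pi_apply (⟨k, by simp⟩ : ({k} : Finset ℕ)))
  have h2 : IndepFun (fun ω => ((fun j : Finset.range k => (D j ω).diag), (D k ω).diag))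
      (fun ω => (Y ω, β₀ ω)) μ :=
    hD_data.comp (φ := fun x : ℕ → Fin d → ℝ => ((fun j : Finset.range k => x j), x k))
      ((measurable_pi_lambda _ fun j : Finset.range k => measurable_pi_apply (j : ℕ)).prodMk
        (measurable_pi_apply k)) measurable_id
  exact (indepFun_prodMk_of_indepFun hpast (hD k) (hY.prodMk hβ₀) h1 h2).symm

theorem measurable_betaTilde (p : ℝ) (X : Matrix (Fin n) (Fin d) ℝ) :
    Measurable (betaTilde p X) :=
  (Continuous.matrix_mulVec continuous_const
    (Continuous.matrix_mulVec continuous_const continuous_id)).measurable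

theorem isErrorProcess_iterate {μ : Measure Ω} [IsProbabilityMeasure μ] {p : unitInterval}
    {D : ℕ → Ω → Matrix (Fin d) (Fin d) ℝ} {Y : Ω → Fin n → ℝ} {β₀ : Ω → Fin d → ℝ}
    {X : Matrix (Fin n) (Fin d) ℝ} (α : ℝ) (hX : ∀ j, X.col j ≠ 0) (hp1 : p < 1)
    (hD : ∀ k, IsDropoutMatrix μ p (D k))
    (hD_indep : iIndepFun (fun k ω => (D k ω).diag) μ)
    (hY : Measurable Y) (hY_sq : SquareIntegrable μ Y)
    (hβ₀ : Measurable β₀) (hβ₀_sq : SquareIntegrable μ β₀)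
    (hD_data : IndepFun (fun ω k => (D k ω).diag) (fun ω => (Y ω, β₀ ω)) μ) :
    IsErrorProcess μ α p (gram X) D (fun ω => betaTilde p X (Y ω))
      (fun k ω => iterate α X D Y β₀ k ω - betaTilde p X (Y ω)) where
  dropout := hD
  symm := isSymm_gram X
  sq_b := (hY_sq.const_mulVec Xᵀ).const_mulVec _
  sq_zero := hβ₀_sq.sub ((hY_sq.const_mulVec Xᵀ).const_mulVec _)
  step k := by
    filter_upwards [(hD k).ae_zero_or_one] with ω hω
    rw [← step_sub_eq hω α p X (Y ω) _ _ (pPart_gram_mulVec_betaTilde hX p.2.1 hp1 (Y ω)),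
      ← (hD k).eq_diagonal ω]
    rfl
  indep k l hl := by
    obtain ⟨φ, hφ, h⟩ :=
      exists_iterate_eq_comp_history (fun k => (hD k).isDiag) α X Y β₀ (le_refl k)
    obtain ⟨ψ, hψ, h'⟩ := exists_iterate_eq_comp_history (fun k => (hD k).isDiag) α X Y β₀ hl
    have hb : Measurable fun z : ((Fin n → ℝ) × (Fin d → ℝ)) × (Finset.range k → Fin d → ℝ) =>
        betaTilde p X z.1.1 :=
      (measurable_betaTilde p X).comp (measurable_fst.comp measurable_fst)
    have := (indepFun_diag_history (fun k => (hD k).measurable_diag) hY hβ₀ hD_indep hD_data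
      k).comp measurable_id ((hφ.sub hb).prodMk (hb.prodMk (hψ.sub hb)))
    refine this.congr (EventuallyEq.refl _ _) (ae_of_all _ fun ω => ?_)
    simp only [Function.comp_apply, Pi.sub_apply, ← h, ← h']
    rfl

/-! ### The marginalized loss -/

theorem sqNorm_eq_dotProduct {m : ℕ} (v : Fin m → ℝ) : sqNorm v = v ⬝ᵥ v := by
  simp [sqNorm, dotProduct, pow_two]

theorem marginalLoss_eq {μ : Measure Ω} [IsProbabilityMeasure μ] {p : unitInterval}
    {D : Ω → Matrix (Fin d) (Fin d) ℝ} (hD : IsDropoutMatrix μ p D)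
    (X : Matrix (Fin n) (Fin d) ℝ) (y : Fin n → ℝ) (β : Fin d → ℝ) :
    marginalLoss μ X D y β
      = y ⬝ᵥ y - 2 * (p * ((Xᵀ *ᵥ y) ⬝ᵥ β)) + p * (β ⬝ᵥ pPart p (gram X) *ᵥ β) := by
  have hx (i : Fin d) : Integrable (fun ω => (D ω).diag i) μ := by
    refine (hD.integrable_mul_diag i i i i).congr ?_
    filter_upwards [hD.ae_sq] with ω h
    rw [h i, h i, h i]
  have hs (i j : Fin d) : Integrable (fun ω => stepMat 1 (gram X) (D ω).diag i j) μ := by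
    obtain ⟨c, hc⟩ := (hD.boundedAlong_stepMat zero_le_one (gram X)).bounded
    refine Integrable.of_bound ?_ c ?_
    · exact ((measurable_stepMat 1 (gram X) i j).comp hD.measurable_diag).aestronglyMeasurable
    · filter_upwards [hc] with ω h using h i j
  -- The quadratic term is expressed through `stepMat` with step size 1, so that `integral_stepMat`
  -- yields the mean `p 𝕏_p` of `D 𝕏 D`.
  have e (ω : Ω) : sqNorm (y - X *ᵥ (D ω *ᵥ β))
      = (y ⬝ᵥ y + β ⬝ᵥ β) - 2 * (∑ i, (Xᵀ *ᵥ y) i * β i * (D ω).diag i)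
        - ∑ i, ∑ j, β i * stepMat 1 (gram X) (D ω).diag i j * β j := by
    rw [← dotProduct_mulVec_eq_sum, sqNorm_eq_dotProduct, hD.eq_diagonal ω, Matrix.diag_diagonal]
    set x := (D ω).diag
    have e1 : ∑ i, (Xᵀ *ᵥ y) i * β i * x i = y ⬝ᵥ X *ᵥ (Matrix.diagonal x *ᵥ β) := by
      rw [Matrix.dotProduct_mulVec, ← Matrix.mulVec_transpose, dotProduct]
      simp only [Matrix.mulVec_diagonal]
      exact Finset.sum_congr rfl fun i _ => by ring
    have e2 : β ⬝ᵥ stepMat 1 (gram X) x *ᵥ β = β ⬝ᵥ β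
        - (X *ᵥ (Matrix.diagonal x *ᵥ β)) ⬝ᵥ (X *ᵥ (Matrix.diagonal x *ᵥ β)) := by
      rw [← quadForm_gram, stepMat, one_smul, Matrix.sub_mulVec, dotProduct_sub, Matrix.one_mulVec,
        ← Matrix.mulVec_mulVec, ← Matrix.mulVec_mulVec, Matrix.dotProduct_mulVec β,
        ← Matrix.mulVec_transpose, Matrix.diagonal_transpose]
    rw [e1, e2, sub_dotProduct, dotProduct_sub, dotProduct_sub,
      dotProduct_comm (X *ᵥ (Matrix.diagonal x *ᵥ β)) y]
    ring
  have i1 : Integrable (fun ω => ∑ i, (Xᵀ *ᵥ y) i * β i * (D ω).diag i) μ :=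
    integrable_finsetSum _ fun i _ => (hx i).const_mul _
  have i2 : Integrable (fun ω => ∑ i, ∑ j, β i * stepMat 1 (gram X) (D ω).diag i j * β j) μ :=
    integrable_finsetSum _ fun i _ => integrable_finsetSum _ fun j _ =>
      ((hs i j).const_mul _).mul_const _
  have v1 : ∫ ω, ∑ i, (Xᵀ *ᵥ y) i * β i * (D ω).diag i ∂μ = p * ((Xᵀ *ᵥ y) ⬝ᵥ β) := by
    rw [integral_finsetSum _ fun i _ => (hx i).const_mul _, dotProduct, Finset.mul_sum]
    refine Finset.sum_congr rfl fun i _ => ?_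
    rw [integral_const_mul]
    simp only [Matrix.diag_apply, hD.integral_diag]
    ring
  have v2 : ∫ ω, ∑ i, ∑ j, β i * stepMat 1 (gram X) (D ω).diag i j * β j ∂μ
      = β ⬝ᵥ β - p * (β ⬝ᵥ pPart p (gram X) *ᵥ β) := by
    rw [integral_finsetSum _ fun i _ => integrable_finsetSum _ fun j _ =>
      ((hs i j).const_mul _).mul_const _]
    have : ∀ i, ∫ ω, ∑ j, β i * stepMat 1 (gram X) (D ω).diag i j * β j ∂μ
        = ∑ j, β i * (1 - (1 * p : ℝ) • pPart p (gram X) : Matrix (Fin d) (Fin d) ℝ) i j * β j := by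
      intro i
      rw [integral_finsetSum _ fun j _ => ((hs i j).const_mul _).mul_const _]
      exact Finset.sum_congr rfl fun j _ => by
        rw [integral_mul_const, integral_const_mul, hD.integral_stepMat]
    simp only [this]
    rw [← dotProduct_mulVec_eq_sum, Matrix.sub_mulVec, Matrix.one_mulVec, Matrix.smul_mulVec,
      dotProduct_sub, dotProduct_smul, one_mul, smul_eq_mul]
  rw [marginalLoss]
  simp only [e]
  rw [integral_sub ?_ i2, integral_sub (integrable_const _) (i1.const_mul 2), integral_const_mul,
    v1, v2, integral_const, probReal_univ, one_smul]
  · ring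
  · exact (integrable_const _).sub (i1.const_mul 2)

/-- Completing the square: the excess loss is `p` times the form of `𝕏_p` at `β - β̃`, which is
positive definite. -/
theorem marginalLoss_betaTilde_lt {μ : Measure Ω} [IsProbabilityMeasure μ] {p : unitInterval}
    (hp0 : 0 < p) (hp1 : p < 1) {D : Ω → Matrix (Fin d) (Fin d) ℝ} (hD : IsDropoutMatrix μ p D)
    {X : Matrix (Fin n) (Fin d) ℝ} (hX : ∀ j, X.col j ≠ 0) (y : Fin n → ℝ) {β : Fin d → ℝ}
    (hβ : β ≠ betaTilde p X y) :
    marginalLoss μ X D y (betaTilde p X y) < marginalLoss μ X D y β := by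
  rw [marginalLoss_eq hD, marginalLoss_eq hD, ← pPart_gram_mulVec_betaTilde hX p.2.1 hp1 y]
  set b := betaTilde p X y
  have hp : (0 : ℝ) < p := hp0
  have hpos := mul_pos hp (quadForm_pPart_pos hX p.2.1 hp1 (sub_ne_zero.2 hβ))
  have hsymm := dotProduct_mulVec_comm_of_isSymm (isSymm_pPart p (isSymm_gram X)) β b
  rw [dotProduct_comm _ b, dotProduct_comm _ β]
  simp only [Matrix.mulVec_sub, sub_dotProduct, dotProduct_sub] at hpos
  rw [hsymm] at hpos ⊢
  linarith

/-! ### The bound for the averages -/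

theorem norm_expOuter_betaTilde_le [Nonempty (Fin d)] {μ : Measure Ω} {p : ℝ} (hp0 : 0 ≤ p)
    (hp1 : p < 1) {X : Matrix (Fin n) (Fin d) ℝ} (hX : ∀ j, X.col j ≠ 0) {Y : Ω → Fin n → ℝ}
    (hY : SquareIntegrable μ Y) :
    ‖expOuter μ (fun ω => betaTilde p X (Y ω)) (fun ω => betaTilde p X (Y ω))‖
      ≤ ‖expOuter μ (fun ω => Xᵀ *ᵥ Y ω) (fun ω => Xᵀ *ᵥ Y ω)‖
        / lambdaMin (pPart p (gram X)) ^ 2 := by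
  have hXY := hY.const_mulVec Xᵀ
  have hinv := norm_pPart_inv_le hX hp0 hp1
  have e : expOuter μ (fun ω => betaTilde p X (Y ω)) (fun ω => betaTilde p X (Y ω))
      = (pPart p (gram X))⁻¹ * ((pPart p (gram X))⁻¹ *
        expOuter μ (fun ω => Xᵀ *ᵥ Y ω) (fun ω => Xᵀ *ᵥ Y ω))ᵀ := by
    rw [← expOuter_const_mulVec_left _ hXY hXY, expOuter_transpose,
      ← expOuter_const_mulVec_left _ hXY (hXY.const_mulVec _)]
    rfl
  rw [e]
  refine (norm_mul_le_of_le hinv ((norm_transpose _).le.trans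
    (norm_mul_le_of_le hinv le_rfl))).trans_eq ?_
  rw [div_eq_mul_inv, ← inv_pow]
  ring

/-- The two error terms, with the contraction gap replaced by its lower bound. -/
theorem average_bound_le {k α p l m g B E S a κ v : ℝ} (hk : 0 < k) (hα : 0 < α) (hp0 : 0 < p)
    (hp1 : p < 1) (hm : 0 < m) (hml : (1 - p) * m ≤ l) (hs1 : α * p * l ≤ 1) (ha : 0 ≤ a)
    (hκ : 0 ≤ κ) (hv : 0 ≤ v) (hE : 0 ≤ E)
    (hS : S ≤ α ^ 2 * p ^ 2 * (1 - p) * (g ^ 2 * B)) (hB : B ≤ E / l ^ 2) :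
    2 * S / (k * (α * p * l) ^ 2)
        + 2 * (a / (α * p * l) ^ 2 + 6 * κ / (α * p * l) ^ 3) / k ^ 2
      ≤ 2 * g ^ 2 * E / (k * (1 - p) ^ 3 * m ^ 4)
        + 2 * (a + 6 * κ + v) / (k ^ 2 * (α * p * (1 - p) * m) ^ 3) := by
  have hp : 0 < 1 - p := sub_pos.2 hp1
  have hl : 0 < l := (mul_pos hp hm).trans_le hml
  refine add_le_add ?_ ?_
  · calc 2 * S / (k * (α * p * l) ^ 2)
        ≤ 2 * (α ^ 2 * p ^ 2 * (1 - p) * (g ^ 2 * (E / l ^ 2))) / (k * (α * p * l) ^ 2) := by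
          gcongr
          exact hS.trans (by gcongr)
      -- The factors `α² p²` of `S₀` cancel against the squared gap. Replacing `l ^ 4` by `((1 - p)
      -- m) ^ 4` then leaves `(1 - p)³` in the denominator.
      _ = 2 * g ^ 2 * E * (1 - p) / (k * l ^ 4) := by field_simp
      _ ≤ 2 * g ^ 2 * E * (1 - p) / (k * ((1 - p) * m) ^ 4) := by gcongr
      _ = _ := by field_simp
  · have hs0 : 0 < α * p * l := by positivity
    have ht : α * p * (1 - p) * m ≤ α * p * l := by
      have := mul_le_mul_of_nonneg_left hml (mul_pos hα hp0).le
      linarith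
    -- Since the gap is at most 1, its square may be replaced by its cube, giving both terms the
    -- same denominator.
    have h1 : a / (α * p * l) ^ 2 ≤ a / (α * p * l) ^ 3 := by
      refine div_le_div_of_nonneg_left ha (by positivity) ?_
      exact pow_le_pow_of_le_one hs0.le hs1 (by norm_num)
    calc 2 * (a / (α * p * l) ^ 2 + 6 * κ / (α * p * l) ^ 3) / k ^ 2
        ≤ 2 * (a / (α * p * l) ^ 3 + 6 * κ / (α * p * l) ^ 3) / k ^ 2 := by gcongr
      _ = 2 * (a + 6 * κ) / (k ^ 2 * (α * p * l) ^ 3) := by field_simp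
      _ ≤ 2 * (a + 6 * κ + v) / (k ^ 2 * (α * p * (1 - p) * m) ^ 3) := by
        refine div_le_div₀ (by positivity) (by linarith) (by positivity) ?_
        gcongr

theorem rpAverage_sub {Ω : Type*} {k : ℕ} (hk : 1 ≤ k) (α : ℝ) (X : Matrix (Fin n) (Fin d) ℝ)
    (D : ℕ → Ω → Matrix (Fin d) (Fin d) ℝ) (Y : Ω → Fin n → ℝ) (β₀ : Ω → Fin d → ℝ)
    (b : Fin d → ℝ) (ω : Ω) :
    rpAverage α X D Y β₀ k ω - b
      = (k : ℝ)⁻¹ • ∑ l ∈ Finset.Icc 1 k, (iterate α X D Y β₀ l ω - b) := by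
  have : (k : ℝ) ≠ 0 := by positivity
  rw [rpAverage, Finset.sum_sub_distrib, Finset.sum_const, Nat.card_Icc, Nat.add_sub_cancel,
    smul_sub, ← Nat.cast_smul_eq_nsmul ℝ, smul_smul, inv_mul_cancel₀ this, one_smul]

/-- The left-hand side is the trace of the second-moment matrix. -/
theorem integral_sqNorm_le {μ : Measure Ω} {U : Ω → Fin d → ℝ} (hU : SquareIntegrable μ U) :
    ∫ ω, sqNorm (U ω) ∂μ ≤ d * ‖expOuter μ U U‖ := by
  simp only [sqNorm, pow_two]
  rw [integral_finsetSum _ fun i _ => hU.integrable_mul hU i i]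
  calc _ ≤ ∑ _i : Fin d, ‖expOuter μ U U‖ :=
        Finset.sum_le_sum fun i _ => (le_abs_self _).trans (abs_apply_le_norm (expOuter μ U U) i i)
    _ = _ := by simp

end Dropout

end

/-! ### The main theorem: step-size arithmetic, the bound and the limit. -/

open Dropout in
theorem mainTheorem3 {Ω : Type*} [MeasurableSpace Ω] (μ : Measure Ω) [IsProbabilityMeasure μ]
    {n d : ℕ} (X : Matrix (Fin n) (Fin d) ℝ)
    -- linear regression model with centered noise of identity covariance
    (βstar : Fin d → ℝ) (ε Y : Ω → Fin n → ℝ)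
    (hY : ∀ ω, Y ω = X *ᵥ βstar + ε ω)
    (hε_meas : Measurable ε) (hε_sq : SquareIntegrable μ ε)
    (hε_mean : expVec μ ε = 0) (hε_cov : expOuter μ ε ε = 1)
    -- learning rate and dropout probability
    (α : ℝ) (hα : 0 < α) (p : unitInterval) (hp0 : 0 < p) (hp1 : p < 1)
    -- i.i.d. dropout matrices, independent of the data and the initialization
    (D : ℕ → Ω → Matrix (Fin d) (Fin d) ℝ)
    (hD : ∀ k, IsDropoutMatrix μ p (D k))
    (hD_indep : iIndepFun (fun k ω => (D k ω).diag) μ)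
    (β₀ : Ω → Fin d → ℝ) (hβ₀_meas : Measurable β₀) (hβ₀_sq : SquareIntegrable μ β₀)
    (hβ₀_indep : IndepFun β₀ Y μ)
    (hD_data : IndepFun (fun ω k => (D k ω).diag) (fun ω => (Y ω, β₀ ω)) μ)
    -- the model is in reduced form
    (hX : ∀ j, X.col j ≠ 0)
    -- step size conditions
    (hα₁ : α * p * ‖gram X‖ < 1)
    (hα₂ : α < lambdaMin (pPart p (gram X)) / (3 * ‖gram X‖ ^ 2)) :
    -- `β̃` is the unique minimizer of the marginalized loss
    (∀ k y β, β ≠ betaTilde p X y →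
      marginalLoss μ X (D k) y (betaTilde p X y) < marginalLoss μ X (D k) y β) ∧
    -- non-asymptotic bound on the second moment of the averages
    (∀ k : ℕ, 1 ≤ k →
      SquareIntegrable μ (fun ω => rpAverage α X D Y β₀ k ω - betaTilde p X (Y ω)) ∧
      ‖expOuter μ (fun ω => rpAverage α X D Y β₀ k ω - betaTilde p X (Y ω))
          (fun ω => rpAverage α X D Y β₀ k ω - betaTilde p X (Y ω))‖
        ≤ 2 * ‖gram X‖ ^ 2 * ‖expOuter μ (fun ω => Xᵀ *ᵥ Y ω) (fun ω => Xᵀ *ᵥ Y ω)‖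
            / (k * (1 - p) ^ 3 * minDiag (gram X) ^ 4)
          + 2 * constC μ α p X Y β₀
            / (k ^ 2 * (α * p * (1 - p) * minDiag (gram X)) ^ 3)) ∧
    -- convergence in quadratic mean
    Tendsto (fun k : ℕ => ∫ ω, sqNorm (rpAverage α X D Y β₀ k ω - betaTilde p X (Y ω)) ∂μ)
      atTop (𝓝 0) := by
  have hp0' : (0 : ℝ) < p := hp0
  have hp1' : (p : ℝ) < 1 := hp1
  -- For `d = 0` the Gram matrix is 0, and division by zero turns the step-size condition into `α <
  -- 0`.
  have hd : Nonempty (Fin d) := by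
    by_contra hne
    rw [not_nonempty_iff] at hne
    have : gram X = 0 := Subsingleton.elim _ _
    rw [this, norm_zero] at hα₂
    norm_num at hα₂
    linarith
  have hYm : Measurable Y := by
    rw [show Y = fun ω => X *ᵥ βstar + ε ω from funext hY]
    exact measurable_const.add hε_meas
  have hYsq : SquareIntegrable μ Y := by
    rw [show Y = fun ω => X *ᵥ βstar + ε ω from funext hY]
    exact SquareIntegrable.add (fun i => memLp_const _) hε_sq
  have hs := isSymm_pPart p (isSymm_gram X)
  have hproc := isErrorProcess_iterate α hX hp1 hD hD_indep hYm hYsq hβ₀_meas hβ₀_sq hD_data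
  have hm := minDiag_gram_pos hX
  have hml := le_lambdaMin hs (minDiag_mul_le_quadForm X hp0'.le hp1'.le)
  have hlg := (lambdaMin_le_norm hs).trans (norm_pPart_le hp0'.le hp1'.le (gram X))
  have hq := norm_one_sub_smul_pPart_le X (mul_pos hα hp0').le hp0'.le hp1'.le hα₁.le
  have hO := norm_offDiag_gram_le X
  set l := lambdaMin (pPart p (gram X)) with hl
  set g := ‖gram X‖ with hg
  have hl0 : 0 < l := (mul_pos (sub_pos.2 hp1') hm).trans_le hml
  have hg0 : 0 < g := hl0.trans_le hlg
  have hα₃ : 3 * α * g ^ 2 ≤ l := by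
    rw [lt_div_iff₀ (by positivity)] at hα₂
    linarith
  -- In fact `3 α g² ≤ l ≤ g` yields `α g ≤ 1 / 3`.
  have hαg : α * g ≤ 1 := by
    have : 3 * (α * g) * g ≤ 1 * g := by linarith
    have := le_of_mul_le_mul_right this hg0
    have : 0 < α * g := by positivity
    linarith
  have hαO : α * ‖offDiag (gram X)‖ ≤ 1 := (mul_le_mul_of_nonneg_left hO hα.le).trans hαg
  have hs1 : α * p * l ≤ 1 :=
    (mul_le_mul_of_nonneg_left hlg (mul_pos hα hp0').le).trans hα₁.le
  have hq1 : 1 - α * p * l < 1 := by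
    have : 0 < α * p * l := by positivity
    linarith
  have hbound : ∀ k : ℕ, 1 ≤ k →
      SquareIntegrable μ (fun ω => rpAverage α X D Y β₀ k ω - betaTilde p X (Y ω)) ∧
      ‖expOuter μ (fun ω => rpAverage α X D Y β₀ k ω - betaTilde p X (Y ω))
          (fun ω => rpAverage α X D Y β₀ k ω - betaTilde p X (Y ω))‖
        ≤ 2 * g ^ 2 * ‖expOuter μ (fun ω => Xᵀ *ᵥ Y ω) (fun ω => Xᵀ *ᵥ Y ω)‖
            / (k * (1 - p) ^ 3 * minDiag (gram X) ^ 4)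
          + 2 * constC μ α p X Y β₀
            / (k ^ 2 * (α * p * (1 - p) * minDiag (gram X)) ^ 3) := by
    intro k hk
    simp only [rpAverage_sub hk]
    refine ⟨fun i => ?_, ?_⟩
    · simp only [Pi.smul_apply, Finset.sum_apply, smul_eq_mul]
      exact (memLp_finsetSum _ fun l _ => hproc.sq hα.le l i).const_mul _
    · refine (hproc.norm_expOuter_average_le hα.le hq1 hq
        (norm_opSLin_le X hα.le hp0'.le hp1'.le hq hl0.le hlg hα₃ _) hαg hαO hk).trans ?_
      rw [sub_sub_cancel]
      exact average_bound_le (by exact_mod_cast hk) hα hp0' hp1' hm hml hs1 (norm_nonneg _)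
        (norm_nonneg _) (Finset.sum_nonneg fun i _ => sq_nonneg _) (norm_nonneg _)
        (norm_opS_zero_le X hp0'.le hp1'.le (isSymm_expOuter _))
        (norm_expOuter_betaTilde_le hp0'.le hp1' hX hYsq)
  refine ⟨fun k y β hβ => marginalLoss_betaTilde_lt hp0 hp1 (hD k) hX y hβ, hbound, ?_⟩
  -- The bound is `a / k + c / k²` with `a` and `c` independent of `k`.
  set a := 2 * g ^ 2 * ‖expOuter μ (fun ω => Xᵀ *ᵥ Y ω) (fun ω => Xᵀ *ᵥ Y ω)‖
    / ((1 - p) ^ 3 * minDiag (gram X) ^ 4) with ha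
  set c := 2 * constC μ α p X Y β₀ / (α * p * (1 - p) * minDiag (gram X)) ^ 3 with hc
  have hlim : Tendsto (fun k : ℕ => (d : ℝ) * (a * (k : ℝ)⁻¹ + c * ((k : ℝ)⁻¹) ^ 2)) atTop
      (𝓝 0) := by
    have h0 := tendsto_inv_atTop_nhds_zero_nat (𝕜 := ℝ)
    simpa using ((h0.const_mul a).add ((h0.pow 2).const_mul c)).const_mul (d : ℝ)
  refine tendsto_of_tendsto_of_tendsto_of_le_of_le' tendsto_const_nhds hlim
    (Eventually.of_forall fun k => integral_nonneg fun ω => Finset.sum_nonneg fun i _ =>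
      sq_nonneg _) ?_
  filter_upwards [eventually_ge_atTop 1] with k hk
  obtain ⟨hsq, hb⟩ := hbound k hk
  refine (integral_sqNorm_le hsq).trans (mul_le_mul_of_nonneg_left (hb.trans_eq ?_)
    (Nat.cast_nonneg d))
  have hk0 : (k : ℝ) ≠ 0 := by positivity
  have hp' : (1 : ℝ) - p ≠ 0 := (sub_pos.2 hp1').ne'
  rw [ha, hc]
  field_simp
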